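/- **Setting.** For $f:\{0,1\}^n\to\mathbb C$ let $\widehat f(\xi)=\mathbb E_{x}[f(x)(-1)^{\langle \xi,x\rangle}]$ for $\xi\in\{0,1\}^n$ ($x$ uniform in $\{0,1\}^n$), and $\mathrm{supp}(\widehat f)=\{\xi:\widehat f(\xi)\neq 0\}$. An oracle for $f$ has $(\rho,\varepsilon)$ *random outlier noise* if each query is, independently of the other queries and of the coins of the algorithm, an outlier with probability $\rho$; a query at $x$ that is not an outlier is answered by some $y\in\mathbb C$ with $|y-f(x)|\le\varepsilon$, and a query that is an outlier is answered arbitrarily. Only the positions of the outliers are random: all answers are chosen, subject to this constraint, by an adversary who may know $f$, all coins of the algorithm and all outlier positions. Algorithms are uniform programs for a real random access machine (exact arithmetic $+,-,\times,/$ and comparison of real numbers at unit cost, no rounding; addition, truncated subtraction and comparison of natural numbers used as indices), with random bits and oracle calls. **Theorem.** There are a randomized oracle algorithm and absolute constants $c_0,C_1,C_2,C_3>0$, $d_2,d_3\in\mathbb N$ such that for all integers $k,n\ge 1$ and reals $\eta>0$, $0<\delta\le 1/2$, the algorithm on input $(k,n,\eta,\delta)$ satisfies the following. 1. For all coins and all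 oracle answers it halts after at most $C_2\,T(\log T)^{d_2}$ queries, where $T=k^2n/\delta^2$ (that is, $\tilde O(k^2n/\delta^2)$ queries), and at most $C_3\,(k+n+1/\delta+1/\eta)^{d_3}$ steps (that is, in time $\mathrm{poly}(k,n,1/\delta,1/\eta)$). 2. For every $f:\{0,1\}^n\to\mathbb C$ with $|\mathrm{supp}(\widehat f)|\le k$ and $|\widehat f(\xi)|\ge\eta$ for every $\xi\in\mathrm{supp}(\widehat f)$, and every $0\le\varepsilon\le c_0\,\eta\,\delta$: given an oracle for $f$ with $(1/2-\delta,\varepsilon)$ random outlier noise, with probability at least $0.99$ over its coins and the outlier positions the algorithm outputs a function $g$ (as a list of frequencies with complex coefficients) such that $$\mathrm{supp}(\widehat g)=\mathrm{supp}(\widehat f)\quad\text{and}\quad \mathbb E_{x}\,|g(x)-f(x)|\le C_1\,\frac{\varepsilon}{\delta}.$$ The algorithm is not given $\varepsilon$. -/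

import Mathlib

open MeasureTheory ProbabilityTheory
open scoped BigOperators

noncomputable section

namespace SparseFFT

/-! ### Fourier analysis on the Boolean cube -/

/-- The Boolean cube `{0,1}^n`, identified with the vector space over the field with two elements. -/
abbrev Cube (n : ℕ) : Type := Fin n → ZMod 2

/-- The character `χ_ξ(x) = (-1)^⟨ξ, x⟩`. -/
def character {n : ℕ} (ξ x : Cube n) : ℂ := (-1) ^ (∑ i, ξ i * x i : ZMod 2).val

/-- The Fourier coefficient of `f` at `ξ`: the average of `f(x) (-1)^⟨ξ, x⟩` over the cube. -/
def cubeFourier {n : ℕ} (f : Cube n → ℂ) (ξ : Cube n) : ℂ :=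
  (∑ x, f x * character ξ x) / (2 : ℂ) ^ n

/-- `E_x |f(x)|` for uniformly random `x` in the cube. -/
def meanAbs {n : ℕ} (f : Cube n → ℂ) : ℝ := (∑ x, ‖f x‖) / (2 : ℝ) ^ n

/-! ### The machine model

A real random access machine with coin flips and an oracle, programmed in a small imperative
language.  A program is a finite object that does not depend on the input or on the dimension `n`;
the only constants in it are natural numbers and integers.  It works on finitely many (named by
numerals) unbounded arrays of natural numbers and of real numbers, all initially zero.  Natural
numbers can be added, subtracted (with truncation) and compared; real numbers can be added,
subtracted, multiplied, divided and compared; there is no rounding of real numbers. -/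

/-- Expressions with natural number values; `read a i` is the entry of array `a` at index `i`. -/
inductive NExp : Type
  | const (c : ℕ) : NExp
  | read (a : ℕ) (i : NExp) : NExp
  | add (e₁ e₂ : NExp) : NExp
  | sub (e₁ e₂ : NExp) : NExp

/-- Expressions with real values; `read a i` is the entry of array `a` at index `i`. -/
inductive RExp : Type
  | const (c : ℤ) : RExp
  | ofNat (e : NExp) : RExp
  | read (a : ℕ) (i : NExp) : RExp
  | add (e₁ e₂ : RExp) : RExp
  | sub (e₁ e₂ : RExp) : RExp
  | mul (e₁ e₂ : RExp) : RExp
  | div (e₁ e₂ : RExp) : RExp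

/-- Tests. -/
inductive BExp : Type
  | nle (e₁ e₂ : NExp) : BExp
  | rle (e₁ e₂ : RExp) : BExp
  | not (b : BExp) : BExp

/-- Programs. -/
inductive Prog : Type
  | skip : Prog
  /-- `nset a i e`: write the value of `e` into the natural number array `a` at index `i`. -/
  | nset (a : ℕ) (i e : NExp) : Prog
  /-- `rset a i e`: write the value of `e` into the real array `a` at index `i`. -/
  | rset (a : ℕ) (i : NExp) (e : RExp) : Prog
  /-- `flip a i`: write a fresh random bit into the natural number array `a` at index `i`. -/
  | flip (a : ℕ) (i : NExp) : Prog
  /-- `query a s b i`: ask the oracle for the point whose `n` bits are the parities of the entries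
  of the natural number array `a` from index `s` on; write the real and the imaginary part of the
  answer into the real array `b` at indices `i` and `i + 1`. -/
  | query (a : ℕ) (s : NExp) (b : ℕ) (i : NExp) : Prog
  | seq (p q : Prog) : Prog
  | cond (b : BExp) (p q : Prog) : Prog
  | loop (b : BExp) (p : Prog) : Prog

/-- The state of the machine: the two families of arrays, the number of random bits consumed so
far, and the list of the points queried so far, in order. -/
structure State (n : ℕ) : Type where
  nat : ℕ → ℕ → ℕ
  real : ℕ → ℕ → ℝ
  coinsUsed : ℕ
  queries : List (Cube n)

namespace NExp

def eval {n : ℕ} (σ : State n) : NExp → ℕ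
  | const c => c
  | read a i => σ.nat a (i.eval σ)
  | add e₁ e₂ => e₁.eval σ + e₂.eval σ
  | sub e₁ e₂ => e₁.eval σ - e₂.eval σ

/-- The number of operations in an expression. -/
def cost : NExp → ℕ
  | const _ => 1
  | read _ i => i.cost + 1
  | add e₁ e₂ => e₁.cost + e₂.cost + 1
  | sub e₁ e₂ => e₁.cost + e₂.cost + 1

end NExp

namespace RExp

def eval {n : ℕ} (σ : State n) : RExp → ℝ
  | const c => (c : ℝ)
  | ofNat e => (e.eval σ : ℝ)
  | read a i => σ.real a (i.eval σ)
  | add e₁ e₂ => e₁.eval σ + e₂.eval σ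
  | sub e₁ e₂ => e₁.eval σ - e₂.eval σ
  | mul e₁ e₂ => e₁.eval σ * e₂.eval σ
  | div e₁ e₂ => e₁.eval σ / e₂.eval σ

/-- The number of operations in an expression. -/
def cost : RExp → ℕ
  | const _ => 1
  | ofNat e => e.cost + 1
  | read _ i => i.cost + 1
  | add e₁ e₂ => e₁.cost + e₂.cost + 1
  | sub e₁ e₂ => e₁.cost + e₂.cost + 1
  | mul e₁ e₂ => e₁.cost + e₂.cost + 1
  | div e₁ e₂ => e₁.cost + e₂.cost + 1

end RExp

namespace BExp

/-- The test succeeds in the state `σ`. -/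
def Holds {n : ℕ} (σ : State n) : BExp → Prop
  | nle e₁ e₂ => e₁.eval σ ≤ e₂.eval σ
  | rle e₁ e₂ => e₁.eval σ ≤ e₂.eval σ
  | not b => ¬ b.Holds σ

/-- The number of operations in a test. -/
def cost : BExp → ℕ
  | nle e₁ e₂ => e₁.cost + e₂.cost + 1
  | rle e₁ e₂ => e₁.cost + e₂.cost + 1
  | not b => b.cost + 1

end BExp

/-- Overwrite the entry of array `a` at index `i` by `v`. -/
def write {α : Type} (m : ℕ → ℕ → α) (a i : ℕ) (v : α) : ℕ → ℕ → α :=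
  Function.update m a (Function.update (m a) i v)

/-- The point of the cube whose bits are the parities of the entries of the array `a` from index
`s` on. -/
def readPoint {n : ℕ} (m : ℕ → ℕ → ℕ) (a s : ℕ) : Cube n := fun i => (m a (s + i) : ZMod 2)

/-- `Exec coins answers p σ t σ'`: started in the state `σ`, the program `p` halts after `t` steps
in the state `σ'`.  Here `coins j` is the `j`-th random bit and `answers j` is the reply of the
oracle to the `j`-th query (counted from zero). A query costs `n` additional steps for the
transmission of the `n`-bit point. -/
inductive Exec {n : ℕ} (coins : ℕ → Bool) (answers : ℕ → ℂ) :
    Prog → State n → ℕ → State n → Prop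
  | skip (σ : State n) : Exec coins answers .skip σ 1 σ
  | nset (σ : State n) (a : ℕ) (i e : NExp) :
      Exec coins answers (.nset a i e) σ (i.cost + e.cost + 1)
        { σ with nat := write σ.nat a (i.eval σ) (e.eval σ) }
  | rset (σ : State n) (a : ℕ) (i : NExp) (e : RExp) :
      Exec coins answers (.rset a i e) σ (i.cost + e.cost + 1)
        { σ with real := write σ.real a (i.eval σ) (e.eval σ) }
  | flip (σ : State n) (a : ℕ) (i : NExp) :
      Exec coins answers (.flip a i) σ (i.cost + 1)
        { σ with
          nat := write σ.nat a (i.eval σ) (coins σ.coinsUsed).toNat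
          coinsUsed := σ.coinsUsed + 1 }
  | query (σ : State n) (a : ℕ) (s : NExp) (b : ℕ) (i : NExp) :
      Exec coins answers (.query a s b i) σ (s.cost + i.cost + n + 1)
        { σ with
          real := write (write σ.real b (i.eval σ) (answers σ.queries.length).re)
            b (i.eval σ + 1) (answers σ.queries.length).im
          queries := σ.queries ++ [readPoint σ.nat a (s.eval σ)] }
  | seq {p q : Prog} {σ σ' σ'' : State n} {t t' : ℕ} :
      Exec coins answers p σ t σ' → Exec coins answers q σ' t' σ'' →
      Exec coins answers (.seq p q) σ (t + t' + 1) σ''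
  | cond_true {b : BExp} {p q : Prog} {σ σ' : State n} {t : ℕ} :
      b.Holds σ → Exec coins answers p σ t σ' →
      Exec coins answers (.cond b p q) σ (b.cost + t + 1) σ'
  | cond_false {b : BExp} {p q : Prog} {σ σ' : State n} {t : ℕ} :
      ¬ b.Holds σ → Exec coins answers q σ t σ' →
      Exec coins answers (.cond b p q) σ (b.cost + t + 1) σ'
  | loop_true {b : BExp} {p : Prog} {σ σ' σ'' : State n} {t t' : ℕ} :
      b.Holds σ → Exec coins answers p σ t σ' → Exec coins answers (.loop b p) σ' t' σ'' →
      Exec coins answers (.loop b p) σ (b.cost + t + t' + 1) σ''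
  | loop_false {b : BExp} {p : Prog} {σ : State n} :
      ¬ b.Holds σ → Exec coins answers (.loop b p) σ (b.cost + 1) σ

/-- The execution is deterministic once the coins and the answers are fixed. -/
theorem Exec.unique {n : ℕ} {coins : ℕ → Bool} {answers : ℕ → ℂ} {p : Prog} {σ σ₁ σ₂ : State n}
    {t₁ t₂ : ℕ} (h₁ : Exec coins answers p σ t₁ σ₁) (h₂ : Exec coins answers p σ t₂ σ₂) :
    t₁ = t₂ ∧ σ₁ = σ₂ := by
  induction h₁ generalizing t₂ σ₂ with
  | skip => cases h₂; exact ⟨rfl, rfl⟩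
  | nset => cases h₂; exact ⟨rfl, rfl⟩
  | rset => cases h₂; exact ⟨rfl, rfl⟩
  | flip => cases h₂; exact ⟨rfl, rfl⟩
  | query => cases h₂; exact ⟨rfl, rfl⟩
  | seq _ _ ih ih' =>
    cases h₂ with
    | seq k k' =>
      obtain ⟨rfl, rfl⟩ := ih k
      obtain ⟨rfl, rfl⟩ := ih' k'
      exact ⟨rfl, rfl⟩
  | cond_true hb _ ih =>
    cases h₂ with
    | cond_true _ k => obtain ⟨rfl, rfl⟩ := ih k; exact ⟨rfl, rfl⟩
    | cond_false hb' _ => exact absurd hb hb'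
  | cond_false hb _ ih =>
    cases h₂ with
    | cond_true hb' _ => exact absurd hb' hb
    | cond_false _ k => obtain ⟨rfl, rfl⟩ := ih k; exact ⟨rfl, rfl⟩
  | loop_true hb _ _ ih ih' =>
    cases h₂ with
    | loop_true _ k k' =>
      obtain ⟨rfl, rfl⟩ := ih k
      obtain ⟨rfl, rfl⟩ := ih' k'
      exact ⟨rfl, rfl⟩
    | loop_false hb' => exact absurd hb hb'
  | loop_false hb =>
    cases h₂ with
    | loop_true hb' _ _ => exact absurd hb' hb
    | loop_false _ => exact ⟨rfl, rfl⟩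

/-- The initial state: natural number arrays `0` and `1` hold `k` and `n`, real arrays `0` and `1`
hold `η` and `δ` (each at index `0`), and everything else is zero. -/
def initState (k n : ℕ) (η δ : ℝ) : State n where
  nat := write (write (fun _ _ => 0) 0 0 k) 1 0 n
  real := write (write (fun _ _ => 0) 0 0 η) 1 0 δ
  coinsUsed := 0
  queries := []

/-- The function `g` described by the output in a final state, as a list of `L` frequencies with
coefficients: `L` is in the natural number array `2` at index `0`, the bits of the `j`-th frequency
are in the natural number array `3` from index `j * n` on, and the real and imaginary parts of the
`j`-th coefficient are in the real arrays `2` and `3` at index `j`. -/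
def output {n : ℕ} (σ : State n) : Cube n → ℂ := fun x =>
  ∑ j ∈ Finset.range (σ.nat 2 0),
    (⟨σ.real 2 j, σ.real 3 j⟩ : ℂ) * character (readPoint σ.nat 3 (j * n)) x

/-! ### Randomness and noise -/

/-- The law of a sequence of independent bits, each equal to `true` with probability `p`. -/
def bitsLaw (p : unitInterval) : Measure (ℕ → Bool) :=
  Measure.infinitePi fun _ => bernoulliMeasure true false p

/-- The joint law of the fair coins of the algorithm and, independent of them, of the outlier
pattern in which each query is an outlier with probability `ρ` independently of the others. -/
def runLaw (ρ : unitInterval) : Measure ((ℕ → Bool) × (ℕ → Bool)) :=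
  (bitsLaw ⟨1 / 2, by norm_num, by norm_num⟩).prod (bitsLaw ρ)

/-- The answers are admissible for the function `f`, the list of queried points and the outlier
pattern: every answer to a query that is not an outlier is within `ε` of the true value.  Answers to
outlier queries are arbitrary. -/
def Admissible {n : ℕ} (f : Cube n → ℂ) (ε : ℝ) (outlier : ℕ → Bool) (queries : List (Cube n))
    (answers : ℕ → ℂ) : Prop :=
  ∀ (j : ℕ) (hj : j < queries.length), outlier j = false → ‖answers j - f queries[j]‖ ≤ ε

end SparseFFT

end

noncomputable section

namespace SparseFFT

section

variable {n : ℕ} {coins : ℕ → Bool} {answers : ℕ → ℂ}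

/-! ### Reasoning about programs -/

/-! The algorithm hashes frequencies into bins by a random linear map and reads each frequency off a
few translates of one random sample. It draws `r` random vectors with `256 k² ≤ 2^r = O(k²)` and
evaluates `f` on all their `2^r` linear combinations, translated by each partial sum `e_0 + … +
e_{l-1}` of the standard basis, `0 ≤ l ≤ n`. On such a combination a character depends only on the
inner products of its frequency with the random vectors and is a row of a Hadamard matrix
(`character_spanVal`). Hence the Walsh–Hadamard transform of the `l`-th translate collects in bin
`b` the terms `f̂(ξ) χ_ξ(e_0 + … + e_{l-1})` with hash value `b`. Two distinct frequencies collide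
with probability `2^{-r}` (`measure_hashBit_eq_zero`), so with probability at least `1 - 1/256` the
support is separated. A bin then holds at most one coefficient, and passing from `l` to `l + 1`
changes its sign exactly when the `l`-th bit of the frequency is `1`.

Outliers are removed point by point. Each of the `N = (n + 1) 2^r` points is queried about `(log₂
N)/δ²` times, and medians of the real and of the imaginary parts are kept. By Hoeffding's inequality
and a union bound, outliers are a minority at every point, except with probability `1/N`
(`measure_majority`), and then each median is within `ε` of the truth (`IsMedian.abs_sub_le`).

The transform is an isometry up to scaling, so the squared bin errors of one translate sum to at
most `2ε²` (`sum_norm_sq_binError_le`), without loss in the number of bins. As `ε ≤ ηδ/4 ≤ η/8`,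
every single error is at most `η/4`. This is small enough to tell empty from occupied bins at the
threshold `η/2` and to read the bits; the `ℓ²` bound on the coefficients also gives the `L¹` bound
(`decoded_correct`).

The adversary gains nothing from knowing the coins and the outlier positions: the queried points
depend on the coins alone (`runs_program`), the favourable event depends only on coins and outlier
positions, and on it correctness holds for every admissible sequence of answers. The remaining work
is to verify, with step counts, that a concrete program carries this out; this uses a small program
logic (`Runs`, `Frame`). -/

/-- The natural number arrays a program may write to. -/
def Prog.nats : Prog → List ℕ
  | skip => []
  | nset a _ _ => [a]
  | rset _ _ _ => []
  | flip a _ => [a]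
  | query _ _ _ _ => []
  | seq p q => p.nats ++ q.nats
  | cond _ p q => p.nats ++ q.nats
  | loop _ p => p.nats

/-- The real arrays a program may write to. -/
def Prog.reals : Prog → List ℕ
  | skip => []
  | nset _ _ _ => []
  | rset a _ _ => [a]
  | flip _ _ => []
  | query _ _ b _ => [b]
  | seq p q => p.reals ++ q.reals
  | cond _ p q => p.reals ++ q.reals
  | loop _ p => p.reals

/-- The program contains no `flip`. -/
def Prog.noFlip : Prog → Bool
  | flip _ _ => false
  | seq p q => p.noFlip && q.noFlip
  | cond _ p q => p.noFlip && q.noFlip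
  | loop _ p => p.noFlip
  | _ => true

/-- The program contains no `query`. -/
def Prog.noQuery : Prog → Bool
  | query _ _ _ _ => false
  | seq p q => p.noQuery && q.noQuery
  | cond _ p q => p.noQuery && q.noQuery
  | loop _ p => p.noQuery
  | _ => true

theorem write_apply {α : Type} (m : ℕ → ℕ → α) (a i : ℕ) (v : α) (b j : ℕ) :
    write m a i v b j = if b = a ∧ j = i then v else m b j := by
  unfold write
  by_cases h : b = a
  · subst h
    by_cases h' : j = i
    · subst h'; simp
    · simp [h']
  · simp [h]

theorem write_ne {α : Type} (m : ℕ → ℕ → α) {a : ℕ} (i : ℕ) (v : α) {b : ℕ} (h : b ≠ a) :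
    write m a i v b = m b := by
  simp [write, h]

/-- What a program leaves unchanged, read off from its text. -/
structure Frame (p : Prog) (σ σ' : State n) : Prop where
  nat : ∀ a, a ∉ p.nats → σ'.nat a = σ.nat a
  real : ∀ a, a ∉ p.reals → σ'.real a = σ.real a
  coinsUsed : p.noFlip = true → σ'.coinsUsed = σ.coinsUsed
  queries : p.noQuery = true → σ'.queries = σ.queries

theorem Frame.refl (p : Prog) (σ : State n) : Frame p σ σ :=
  ⟨fun _ _ => rfl, fun _ _ => rfl, fun _ => rfl, fun _ => rfl⟩

/-- The text of `r` only has to contain those of `p` and `q`. One statement thus serves sequences,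
branches (with `skip` as the missing half) and loops (with `p`, `q` and `r` sharing the same
effects). -/
theorem Frame.trans {p q r : Prog} {σ σ' σ'' : State n} (h : Frame p σ σ') (h' : Frame q σ' σ'')
    (hp : p.nats ⊆ r.nats) (hq : q.nats ⊆ r.nats) (hp' : p.reals ⊆ r.reals)
    (hq' : q.reals ⊆ r.reals) (hf : r.noFlip = true → p.noFlip = true ∧ q.noFlip = true)
    (ho : r.noQuery = true → p.noQuery = true ∧ q.noQuery = true) : Frame r σ σ'' where
  nat a ha := (h'.nat a fun m => ha (hq m)).trans (h.nat a fun m => ha (hp m))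
  real a ha := (h'.real a fun m => ha (hq' m)).trans (h.real a fun m => ha (hp' m))
  coinsUsed e := (h'.coinsUsed (hf e).2).trans (h.coinsUsed (hf e).1)
  queries e := (h'.queries (ho e).2).trans (h.queries (ho e).1)

theorem Exec.frame {p : Prog} {σ σ' : State n} {t : ℕ} (h : Exec coins answers p σ t σ') :
    Frame p σ σ' := by
  induction h with
  | skip => exact Frame.refl _ _
  | nset σ a i e =>
    refine ⟨fun b hb => ?_, fun _ _ => rfl, fun _ => rfl, fun _ => rfl⟩
    exact write_ne _ _ _ (by simpa [Prog.nats] using hb)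
  | rset σ a i e =>
    refine ⟨fun _ _ => rfl, fun b hb => ?_, fun _ => rfl, fun _ => rfl⟩
    exact write_ne _ _ _ (by simpa [Prog.reals] using hb)
  | flip σ a i =>
    refine ⟨fun b hb => ?_, fun _ _ => rfl, fun h => by simp [Prog.noFlip] at h, fun _ => rfl⟩
    exact write_ne _ _ _ (by simpa [Prog.nats] using hb)
  | query σ a s b i =>
    refine ⟨fun _ _ => rfl, fun c hc => ?_, fun _ => rfl, fun h => by simp [Prog.noQuery] at h⟩
    have hc : c ≠ b := by simpa [Prog.reals] using hc
    exact (write_ne _ _ _ hc).trans (write_ne _ _ _ hc)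
  | seq _ _ ih ih' =>
    exact ih.trans ih' (by simp [Prog.nats]) (by simp [Prog.nats]) (by simp [Prog.reals])
      (by simp [Prog.reals]) (by simp [Prog.noFlip]) (by simp [Prog.noQuery])
  | cond_true _ _ ih =>
    exact ih.trans (Frame.refl .skip _) (by simp [Prog.nats]) (by simp [Prog.nats])
      (by simp [Prog.reals]) (by simp [Prog.reals])
      (by simp +contextual [Prog.noFlip]) (by simp +contextual [Prog.noQuery])
  | cond_false _ _ ih =>
    exact ih.trans (Frame.refl .skip _) (by simp [Prog.nats]) (by simp [Prog.nats])
      (by simp [Prog.reals]) (by simp [Prog.reals])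
      (by simp +contextual [Prog.noFlip]) (by simp +contextual [Prog.noQuery])
  | loop_true _ _ _ ih ih' =>
    exact ih.trans ih' (by simp [Prog.nats]) (by simp [Prog.nats]) (by simp [Prog.reals])
      (by simp [Prog.reals]) (by simp +contextual [Prog.noFlip])
      (by simp +contextual [Prog.noQuery])
  | loop_false => exact Frame.refl _ _

/-- Started in `σ`, the program halts within `B` steps in a state that satisfies `Q`. -/
def Runs (coins : ℕ → Bool) (answers : ℕ → ℂ) (p : Prog) (σ : State n) (B : ℕ)
    (Q : State n → Prop) : Prop :=
  ∃ t σ', Exec coins answers p σ t σ' ∧ t ≤ B ∧ Q σ'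

/-! ### Proof rules with step budgets -/

namespace Runs

variable {p q : Prog} {σ : State n} {B B' : ℕ} {Q Q' : State n → Prop} {b : BExp}

/-- The frame comes free with every execution, so postconditions need only describe what a program
changes; facts about untouched arrays are recovered afterwards from the text of the program. -/
theorem mono (h : Runs coins answers p σ B Q) (hB : B ≤ B')
    (hQ : ∀ σ', Frame p σ σ' → Q σ' → Q' σ') : Runs coins answers p σ B' Q' := by
  obtain ⟨t, σ', h, ht, hq⟩ := h
  exact ⟨t, σ', h, ht.trans hB, hQ _ h.frame hq⟩

theorem weaken (h : Runs coins answers p σ B Q) (hB : B ≤ B') : Runs coins answers p σ B' Q :=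
  h.mono hB fun _ _ h => h

theorem skip (h : Q σ) : Runs coins answers .skip σ 1 Q := ⟨_, _, .skip σ, le_rfl, h⟩

theorem nset {a : ℕ} {i e : NExp}
    (h : Q { σ with nat := write σ.nat a (i.eval σ) (e.eval σ) }) :
    Runs coins answers (.nset a i e) σ (i.cost + e.cost + 1) Q := ⟨_, _, .nset σ a i e, le_rfl, h⟩

theorem rset {a : ℕ} {i : NExp} {e : RExp}
    (h : Q { σ with real := write σ.real a (i.eval σ) (e.eval σ) }) :
    Runs coins answers (.rset a i e) σ (i.cost + e.cost + 1) Q := ⟨_, _, .rset σ a i e, le_rfl, h⟩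

theorem flip {a : ℕ} {i : NExp}
    (h : Q { σ with
      nat := write σ.nat a (i.eval σ) (coins σ.coinsUsed).toNat
      coinsUsed := σ.coinsUsed + 1 }) :
    Runs coins answers (.flip a i) σ (i.cost + 1) Q := ⟨_, _, .flip σ a i, le_rfl, h⟩

theorem query {a : ℕ} {s : NExp} {b : ℕ} {i : NExp}
    (h : Q { σ with
      real := write (write σ.real b (i.eval σ) (answers σ.queries.length).re)
        b (i.eval σ + 1) (answers σ.queries.length).im
      queries := σ.queries ++ [readPoint σ.nat a (s.eval σ)] }) :
    Runs coins answers (.query a s b i) σ (s.cost + i.cost + n + 1) Q :=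
  ⟨_, _, .query σ a s b i, le_rfl, h⟩

theorem seq (h : Runs coins answers p σ B fun σ' => Runs coins answers q σ' B' Q) :
    Runs coins answers (.seq p q) σ (B + B' + 1) Q := by
  obtain ⟨t, σ', h, ht, t', σ'', h', ht', hQ⟩ := h
  exact ⟨_, _, .seq h h', by omega, hQ⟩

theorem andThen {Q₁ : State n → Prop} (B₁ B₂ : ℕ) (h₁ : Runs coins answers p σ B₁ Q₁)
    (h₂ : ∀ σ', Frame p σ σ' → Q₁ σ' → Runs coins answers q σ' B₂ Q) (hB : B₁ + B₂ + 1 ≤ B) :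
    Runs coins answers (.seq p q) σ B Q :=
  (seq (h₁.mono le_rfl h₂)).weaken hB

theorem nsetThen {a : ℕ} {i e : NExp} (B₂ : ℕ)
    (h : Runs coins answers q { σ with nat := write σ.nat a (i.eval σ) (e.eval σ) } B₂ Q)
    (hB : i.cost + e.cost + B₂ + 2 ≤ B) : Runs coins answers (.seq (.nset a i e) q) σ B Q :=
  (seq (nset h)).weaken (by omega)

/-- The budgets of the branches are added instead of taking their maximum. This is wasteful but
harmless for polynomial bounds. -/
theorem cond (h : b.Holds σ → Runs coins answers p σ B Q)
    (h' : ¬ b.Holds σ → Runs coins answers q σ B' Q) :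
    Runs coins answers (.cond b p q) σ (b.cost + (B + B') + 1) Q := by
  by_cases hb : b.Holds σ
  · obtain ⟨t, σ', h, ht, hQ⟩ := h hb
    exact ⟨_, _, .cond_true hb h, by omega, hQ⟩
  · obtain ⟨t, σ', h, ht, hQ⟩ := h' hb
    exact ⟨_, _, .cond_false hb h, by omega, hQ⟩

/-- A loop that is executed `K` times. -/
theorem loop (K : ℕ) (I : ℕ → State n → Prop) (h0 : I 0 σ)
    (hb : ∀ i ≤ K, ∀ σ', I i σ' → Frame p σ σ' → (b.Holds σ' ↔ i < K))
    (hs : ∀ i < K, ∀ σ', I i σ' → Frame p σ σ' → Runs coins answers p σ' B (I (i + 1))) :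
    Runs coins answers (.loop b p) σ (K * (B + b.cost + 1) + b.cost + 1) (I K) := by
  -- Induction on the number `d` of remaining iterations, carrying the frame relative to the
  -- original state.
  have key : ∀ d i, i + d = K → ∀ σ', I i σ' → Frame p σ σ' →
      Runs coins answers (.loop b p) σ' (d * (B + b.cost + 1) + b.cost + 1) (I K) := by
    intro d
    induction d with
    | zero =>
      intro i hi σ' hI hF
      obtain rfl : i = K := by omega
      refine ⟨_, _, .loop_false ?_, by omega, hI⟩
      rw [hb _ le_rfl σ' hI hF]; omega
    | succ d ih =>
      intro i hi σ' hI hF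
      obtain ⟨t, σ₁, h₁, ht, hI₁⟩ := hs i (by omega) σ' hI hF
      have hF₁ : Frame p σ σ₁ := hF.trans h₁.frame (by simp) (by simp) (by simp) (by simp)
        (by simp) (by simp)
      obtain ⟨t', σ₂, h₂, ht', hI₂⟩ := ih (i + 1) (by omega) σ₁ hI₁ hF₁
      refine ⟨_, _, .loop_true ((hb i (by omega) σ' hI hF).2 (by omega)) h₁ h₂, ?_, hI₂⟩
      rw [add_mul]; omega
  exact key K 0 (by omega) σ h0 (Frame.refl _ _)

end Runs

/-- `rd a` reads the scalar variable `a`. -/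
abbrev rd (a : ℕ) : NExp := .read a (.const 0)

/-- `assign a e` writes the scalar variable `a`. -/
abbrev assign (a : ℕ) (e : NExp) : Prog := .nset a (.const 0) e

/-- `for v < e do p`. -/
def forLoop (v : ℕ) (e : NExp) (p : Prog) : Prog :=
  .seq (assign v (.const 0))
    (.loop (.not (.nle e (rd v))) (.seq p (assign v (.add (rd v) (.const 1)))))

/-- The body establishes the invariant in the state where the counter has already been advanced, so
the increment is handled once and for all here. The bound `e` may be re-evaluated in every round; it
only has to keep the value `K`. The numerical constants are rounded up. -/
theorem Runs.forLoop {v : ℕ} {e : NExp} {p : Prog} {σ : State n} {B : ℕ} (K : ℕ)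
    (I : ℕ → State n → Prop) (h0 : I 0 { σ with nat := write σ.nat v 0 0 })
    (he : ∀ i ≤ K, ∀ σ', I i σ' → Frame (SparseFFT.forLoop v e p) σ σ' → e.eval σ' = K)
    (hv : v ∉ p.nats)
    (hs : ∀ i < K, ∀ σ', I i σ' → Frame (SparseFFT.forLoop v e p) σ σ' → σ'.nat v 0 = i →
      Runs coins answers p σ' B
        (fun σ'' => I (i + 1) { σ'' with nat := write σ''.nat v 0 (i + 1) })) :
    Runs coins answers (SparseFFT.forLoop v e p) σ (K * (B + e.cost + 15) + e.cost + 10) (I K) := by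
  have hF0 : ∀ {σ' : State n}, Frame (.seq p (assign v (.add (rd v) (.const 1))))
      { σ with nat := write σ.nat v 0 0 } σ' → Frame (SparseFFT.forLoop v e p) σ σ' := by
    intro σ' hF
    have h₁ : Frame (assign v (.const 0)) σ { σ with nat := write σ.nat v 0 0 } :=
      Exec.frame (coins := fun _ => false) (answers := fun _ => 0)
        (.nset σ v (.const 0) (.const 0))
    exact h₁.trans hF (by simp [SparseFFT.forLoop, Prog.nats])
      (by simp [SparseFFT.forLoop, Prog.nats]) (by simp [SparseFFT.forLoop, Prog.reals])
      (by simp [SparseFFT.forLoop, Prog.reals]) (by simp [SparseFFT.forLoop, Prog.noFlip])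
      (by simp [SparseFFT.forLoop, Prog.noQuery])
  have hloop := Runs.loop (coins := coins) (answers := answers)
    (b := .not (.nle e (rd v))) (p := .seq p (assign v (.add (rd v) (.const 1))))
    (σ := { σ with nat := write σ.nat v 0 0 }) (B := B + (1 + 4 + 1) + 1) K
    (fun i σ' => I i σ' ∧ σ'.nat v 0 = i) ⟨h0, by simp [write_apply]⟩ ?_ ?_
  · refine Runs.mono (Runs.seq (Runs.nset hloop)) ?_ fun _ _ h => h.1
    simp only [BExp.cost, NExp.cost]
    have : K * (B + (1 + 4 + 1) + 1 + (e.cost + (1 + 1) + 1 + 1) + 1) ≤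
        K * (B + e.cost + 15) := Nat.mul_le_mul_left _ (by omega)
    omega
  · rintro i hi σ' ⟨hI, hv'⟩ hF
    simp [BExp.Holds, NExp.eval, hv', he i hi σ' hI (hF0 hF)]
  · rintro i hi σ' ⟨hI, hv'⟩ hF
    refine Runs.seq ((hs i hi σ' hI (hF0 hF) hv').mono le_rfl fun σ'' hF' hI' => ?_)
    refine Runs.nset ?_
    have : σ''.nat v 0 = i := by rw [hF'.nat v hv, hv']
    simpa [NExp.eval, this, write_apply] using hI'

end

section

variable {n : ℕ} {coins : ℕ → Bool} {answers : ℕ → ℂ}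

theorem write_write {α : Type} (m : ℕ → ℕ → α) (a i : ℕ) (v w : α) :
    write (write m a i v) a i w = write m a i w := by
  funext b j
  simp only [write_apply]
  split_ifs <;> rfl

/-- The machine has no division, so a column index modulo `n` is maintained by incrementing and
resetting; this is the arithmetic behind `advanceColumn`. -/
theorem succ_mod_eq_ite (s : ℕ) (hn : 0 < n) :
    (s + 1) % n = if n ≤ s % n + 1 then 0 else s % n + 1 := by
  have h := Nat.mod_lt s hn
  rw [Nat.add_mod]
  split_ifs with h'
  · obtain rfl | hn1 : n = 1 ∨ 1 < n := by omega
    · omega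
    · rw [Nat.mod_eq_of_lt hn1, show s % n + 1 = n by omega, Nat.mod_self]
  · have hn1 : 1 < n := by omega
    rw [Nat.mod_eq_of_lt hn1, Nat.mod_eq_of_lt (by omega)]

/-! ### The span of random vectors -/

/-- Increase the variable `12` modulo the dimension. -/
def advanceColumn : Prog :=
  .seq (assign 12 (.add (rd 12) (.const 1)))
    (.cond (.nle (rd 1) (rd 12)) (assign 12 (.const 0)) .skip)

theorem runs_advanceColumn {σ : State n} {Q : State n → Prop} {s : ℕ} (hn : 0 < n)
    (h1 : σ.nat 1 0 = n) (hs : σ.nat 12 0 = s % n)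
    (hQ : Q { σ with nat := write σ.nat 12 0 ((s + 1) % n) }) :
    Runs coins answers advanceColumn σ 20 Q := by
  rw [succ_mod_eq_ite s hn] at hQ
  refine Runs.weaken (Runs.seq (Runs.nset (Runs.cond (fun h => Runs.nset ?_)
    (fun h => Runs.skip ?_)))) (by simp [NExp.cost, BExp.cost])
  · simp only [BExp.Holds, NExp.eval, write_apply, h1, hs] at h
    rw [if_pos (by simpa using h)] at hQ
    simpa [NExp.eval, write_write] using hQ
  · simp only [BExp.Holds, NExp.eval, write_apply, h1, hs] at h
    rw [if_neg (by simpa using h)] at hQ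
    simpa [NExp.eval, hs] using hQ

/-- The bits of the vectors drawn by the algorithm. -/
def coinVec (coins : ℕ → Bool) (n t l : ℕ) : ZMod 2 := ((coins (t * n + l)).toNat : ZMod 2)

/-- The `l`-th coordinate of the combination of `v 0, …, v (t - 1)` whose coefficients are the
binary digits of `u`. -/
def spanVal (v : ℕ → ℕ → ZMod 2) : ℕ → ℕ → ℕ → ZMod 2
  | 0, _, _ => 0
  | t + 1, u, l => if u < 2 ^ t then spanVal v t u l else spanVal v t (u - 2 ^ t) l + v t l

/-- Draw a new random vector and double the table of linear combinations in array `7`. -/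
def extendSpan : Prog :=
  .seq (forLoop 8 (rd 1) (.flip 6 (rd 8))) <|
  .seq (assign 12 (.const 0)) <|
  .seq (forLoop 8 (rd 13)
    (.seq (.nset 7 (.add (rd 13) (rd 8)) (.add (.read 7 (rd 8)) (.read 6 (rd 12))))
      advanceColumn)) <|
  .seq (assign 13 (.add (rd 13) (rd 13))) <|
  .seq (assign 4 (.add (rd 4) (rd 4))) (assign 5 (.add (rd 5) (.const 1)))

/-- After `t` rounds, the table of linear combinations is complete for `t` vectors. -/
structure SpanTable (coins : ℕ → Bool) (t : ℕ) (σ : State n) : Prop where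
  size : σ.nat 4 0 = 2 ^ t
  rounds : σ.nat 5 0 = t
  length : σ.nat 13 0 = 2 ^ t * n
  coinsUsed : σ.coinsUsed = t * n
  table : ∀ s < 2 ^ t * n, (σ.nat 7 s : ZMod 2) = spanVal (coinVec coins n) t (s / n) (s % n)

/-- The flattened table keeps coordinate `l` of combination `u` at index `u * n + l`. Appending a
copy with the new vector added realises the recursion of `spanVal` on the top digit of `u`. Entries
are never reduced modulo `2`; only their parities matter. -/
theorem runs_extendSpan {σ : State n} {t : ℕ} (hn : 0 < n) (h1 : σ.nat 1 0 = n)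
    (h : SpanTable coins t σ) :
    Runs coins answers extendSpan σ (200 * (2 ^ t * n) + 200) (SpanTable coins (t + 1)) := by
  have hflip : Runs coins answers (forLoop 8 (rd 1) (.flip 6 (rd 8))) σ (n * 20 + 20)
      (fun σ' => σ'.coinsUsed = (t + 1) * n ∧
        ∀ l < n, (σ'.nat 6 l : ZMod 2) = coinVec coins n t l) := by
    refine (Runs.forLoop (B := 3) n (fun i σ' => σ'.coinsUsed = t * n + i ∧
        ∀ l < i, (σ'.nat 6 l : ZMod 2) = coinVec coins n t l) ?_ ?_ (by decide) ?_).mono ?_ ?_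
    · simp [h.coinsUsed]
    · intro i hi σ' hI hF
      simp [NExp.eval, hF.nat 1 (by decide), h1]
    · rintro i hi σ' ⟨hc, hl⟩ hF hv
      refine Runs.weaken (Runs.flip ⟨by simp [hc]; ring, fun l hl' => ?_⟩) (by simp [NExp.cost])
      simp only [write_apply, NExp.eval, hv, hc]
      rcases eq_or_ne l i with rfl | hne
      · simp [coinVec]
      · simpa [hne] using hl l (by omega)
    · simp [NExp.cost]
    · rintro σ' - ⟨hc, hl⟩
      exact ⟨by rw [hc]; ring, hl⟩
  rw [extendSpan]
  refine Runs.andThen _ (100 * (2 ^ t * n) + 150) hflip ?_ ?_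
  · intro σ₁ hF₁ ⟨hc₁, hv₁⟩
    refine Runs.nsetThen (100 * (2 ^ t * n) + 100) ?_
      (by simp only [NExp.cost]; omega)
    refine Runs.andThen _ 50 (Runs.forLoop (B := 50) (2 ^ t * n) (fun i σ' =>
      σ'.nat 12 0 = i % n ∧ ∀ s < 2 ^ t * n + i,
        (σ'.nat 7 s : ZMod 2) = spanVal (coinVec coins n) (t + 1) (s / n) (s % n))
        ⟨?_, ?_⟩ ?_ (by decide) ?_) ?_ (by simp only [NExp.cost]; omega)
    · simp [write_apply, NExp.eval]
    · intro s hs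
      have hs : s < 2 ^ t * n := by simpa using hs
      have h7 := congrFun (hF₁.nat 7 (by decide)) s
      have : s / n < 2 ^ t := Nat.div_lt_of_lt_mul (by rwa [mul_comm])
      simp [write_apply, h7, h.table s hs, spanVal, this]
    · intro i hi σ' _ hF
      simp [NExp.eval, hF.nat 13 (by decide), hF₁.nat 13 (by decide), write_apply, h.length]
    · rintro i hi σ' ⟨h12, h7⟩ hF h8
      have e13 : σ'.nat 13 0 = 2 ^ t * n := by
        simp [hF.nat 13 (by decide), hF₁.nat 13 (by decide), write_apply, h.length]
      have e1 : σ'.nat 1 0 = n := by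
        simp [hF.nat 1 (by decide), hF₁.nat 1 (by decide), write_apply, h1]
      have e6 : ∀ l < n, (σ'.nat 6 l : ZMod 2) = coinVec coins n t l := by
        intro l hl
        simpa [hF.nat 6 (by decide), write_apply] using hv₁ l hl
      refine Runs.weaken (Runs.seq (Runs.nset (runs_advanceColumn (s := i) hn ?_ ?_ ?_)))
        (by simp [NExp.cost])
      · simp [write_apply, NExp.eval, e1]
      · simp [write_apply, NExp.eval, h12]
      · refine ⟨by simp [write_apply], fun s hs => ?_⟩
        simp only [write_apply, NExp.eval, e13, h8, h12]
        rcases eq_or_ne s (2 ^ t * n + i) with rfl | hne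
        · have hd : (2 ^ t * n + i) / n = 2 ^ t + i / n := by
            rw [add_comm, Nat.add_mul_div_right _ _ hn, add_comm]
          have hm : (2 ^ t * n + i) % n = i % n := by
            rw [add_comm, Nat.add_mul_mod_self_right]
          have h7i := h7 i (by omega)
          have : i / n < 2 ^ t := Nat.div_lt_of_lt_mul (by rwa [mul_comm])
          simp only [spanVal, this, if_true] at h7i
          simp [hd, hm, spanVal, h7i, e6 _ (Nat.mod_lt i hn)]
        · simpa [hne] using h7 s (by omega)
    · rintro σ₂ hF₂ ⟨-, h7⟩
      refine Runs.weaken (Runs.seq (Runs.nset (Runs.seq (Runs.nset (Runs.nset ?_)))))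
        (by simp [NExp.cost])
      have e13 : σ₂.nat 13 0 = 2 ^ t * n := by
        simp [hF₂.nat 13 (by decide), hF₁.nat 13 (by decide), write_apply, h.length]
      have e4 : σ₂.nat 4 0 = 2 ^ t := by
        simp [hF₂.nat 4 (by decide), hF₁.nat 4 (by decide), write_apply, h.size]
      have e5 : σ₂.nat 5 0 = t := by
        simp [hF₂.nat 5 (by decide), hF₁.nat 5 (by decide), write_apply, h.rounds]
      have ec : σ₂.coinsUsed = (t + 1) * n := by
        simpa [hF₂.coinsUsed (by decide)] using hc₁
      refine ⟨?_, ?_, ?_, ec, fun s hs => ?_⟩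
      · simp [write_apply, NExp.eval, e4]; ring
      · simp [write_apply, NExp.eval, e5]
      · simp [write_apply, NExp.eval, e13]; ring
      · simpa [write_apply, NExp.eval] using h7 s (by rw [pow_succ] at hs; linarith)
  · have : n ≤ 2 ^ t * n := Nat.le_mul_of_pos_left _ (by positivity)
    omega

end

section

variable {n : ℕ} {coins : ℕ → Bool} {answers : ℕ → ℂ}

/-- The number of random vectors. -/
def rounds (k : ℕ) : ℕ := Nat.clog 2 (256 * k ^ 2)

/-- Draw the random vectors and compute all their linear combinations. -/
def buildSpan : Prog :=
  .seq (assign 4 (.const 1)) <|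
  .seq (assign 13 (rd 1)) <|
  .loop (.not (.rle (.mul (.const 256) (.mul (.ofNat (rd 0)) (.ofNat (rd 0)))) (.ofNat (rd 4))))
    extendSpan

/-- The initial table is the zero vector, supplied by the zero-initialised array. Natural numbers
cannot be multiplied, so `256 k² ≤ 2^t` is tested in real arithmetic; the first `t` passing the test
is `rounds k`. -/
theorem runs_buildSpan {σ : State n} {k : ℕ} (hn : 0 < n) (h0 : σ.nat 0 0 = k)
    (h1 : σ.nat 1 0 = n) (h5 : σ.nat 5 0 = 0) (h7 : ∀ s, σ.nat 7 s = 0) (hc : σ.coinsUsed = 0) :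
    Runs coins answers buildSpan σ (rounds k * (200 * (2 ^ rounds k * n) + 220) + 40)
      (SpanTable coins (rounds k)) := by
  rw [buildSpan]
  have hloop := Runs.loop (coins := coins) (answers := answers)
    (b := .not (.rle (.mul (.const 256) (.mul (.ofNat (rd 0)) (.ofNat (rd 0)))) (.ofNat (rd 4))))
    (p := extendSpan)
    (σ := { σ with nat := write (write σ.nat 4 0 1) 13 0 n }) (B := 200 * (2 ^ rounds k * n) + 200)
    (rounds k) (SpanTable coins) ?_ ?_ ?_
  · refine Runs.nsetThen (rounds k * (200 * (2 ^ rounds k * n) + 220) + 30) ?_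
      (by simp only [NExp.cost]; omega)
    refine Runs.nsetThen (rounds k * (200 * (2 ^ rounds k * n) + 220) + 20) ?_
      (by simp only [NExp.cost]; omega)
    simp only [NExp.eval, write_apply, h1]
    refine hloop.weaken ?_
    simp only [BExp.cost, RExp.cost, NExp.cost]
    have : ∀ x, rounds k * (x + 200 + (1 + (1 + 1 + 1 + (1 + 1 + 1) + 1) + 1 + (1 + 1 + 1) + 1 + 1) + 1) ≤
        rounds k * (x + 220) := fun x => Nat.mul_le_mul_left _ (by omega)
    have := this (200 * (2 ^ rounds k * n))
    omega
  · refine ⟨by simp [write_apply], by simp [write_apply, h5], by simp [write_apply], by simp [hc],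
      fun s hs => ?_⟩
    simp [write_apply, h7, spanVal]
  · intro i hi σ' hI hF
    have e0 : σ'.nat 0 0 = k := by simp [hF.nat 0 (by decide), write_apply, h0]
    simp only [BExp.Holds, RExp.eval, NExp.eval, e0, hI.size, not_le]
    rw [rounds, Nat.lt_clog_iff_pow_lt (by norm_num)]
    rw [← Nat.cast_lt (α := ℝ)]
    push_cast
    rw [pow_two]
  · intro i hi σ' hI hF
    have e1 : σ'.nat 1 0 = n := by simp [hF.nat 1 (by decide), write_apply, h1]
    refine (runs_extendSpan hn e1 hI).weaken ?_
    have : 2 ^ i ≤ 2 ^ rounds k := Nat.pow_le_pow_right (by norm_num) hi.le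
    gcongr

/-! ### The shifted points -/

/-- Append the translates of the table by the partial sums of the standard basis. -/
def buildShifts : Prog :=
  .seq (assign 14 (rd 4)) <|
  .seq (assign 11 (.const 0)) <|
  forLoop 9 (rd 1) <|
    .seq (assign 12 (.const 0)) <|
    .seq (forLoop 8 (rd 13)
      (.seq (.nset 7 (.add (rd 11) (rd 13))
        (.add (.read 7 (rd 11))
          (.sub (.sub (.const 1) (.sub (rd 12) (rd 9))) (.sub (rd 9) (rd 12)))))
      (.seq (assign 11 (.add (rd 11) (.const 1))) advanceColumn)))
    (assign 14 (.add (rd 14) (rd 4)))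

/-- The number of points to be evaluated. -/
def numPoints (k n : ℕ) : ℕ := (n + 1) * 2 ^ rounds k

/-- The `l`-th coordinate of the `P`-th point. -/
def pointVal (coins : ℕ → Bool) (n r P l : ℕ) : ZMod 2 :=
  spanVal (coinVec coins n) r (P % 2 ^ r) l + if l < P / 2 ^ r then 1 else 0

/-- Block `i + 1` is block `i` with the basis vector `e_i` added, so each entry is computed from the
one lying a distance `2^r * n` before it. -/
theorem runs_buildShifts {σ : State n} {r : ℕ} (hn : 0 < n) (h1 : σ.nat 1 0 = n)
    (h : SpanTable coins r σ) :
    Runs coins answers buildShifts σ (n * (2 ^ r * n * 100 + 100) + 100) (fun σ' =>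
      σ'.nat 14 0 = (n + 1) * 2 ^ r ∧
      ∀ s < (n + 1) * 2 ^ r * n, (σ'.nat 7 s : ZMod 2) = pointVal coins n r (s / n) (s % n)) := by
  rw [buildShifts]
  set D := 2 ^ r * n with hD
  have hDn : ∀ x, (x * D) % n = 0 := fun x => by rw [hD, ← mul_assoc]; exact Nat.mul_mod_left _ _
  refine Runs.nsetThen (n * (D * 100 + 100) + 90) ?_ (by simp only [NExp.cost]; omega)
  refine Runs.nsetThen (n * (D * 100 + 100) + 80) ?_ (by simp only [NExp.cost]; omega)
  refine (Runs.forLoop (B := D * 100 + 50) n (fun i σ' =>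
    σ'.nat 14 0 = (i + 1) * 2 ^ r ∧ σ'.nat 11 0 = i * D ∧
      ∀ s < (i + 1) * D, (σ'.nat 7 s : ZMod 2) = pointVal coins n r (s / n) (s % n))
    ⟨?_, ?_, ?_⟩ ?_ (by decide) ?_).mono ?_ ?_
  · simp [write_apply, NExp.eval, h.size]
  · simp [write_apply, NExp.eval]
  · intro s hs
    rw [zero_add, one_mul] at hs
    have hd : s / n < 2 ^ r := Nat.div_lt_of_lt_mul (by rwa [mul_comm])
    simp [write_apply, NExp.eval, h.table s hs, pointVal, Nat.mod_eq_of_lt hd, Nat.div_eq_of_lt hd]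
  · intro i hi σ' _ hF
    simp [NExp.eval, hF.nat 1 (by decide), write_apply, h1]
  · rintro i hi σ' ⟨h14, h11, h7⟩ hF h9
    have e13 : σ'.nat 13 0 = D := by simp [hF.nat 13 (by decide), write_apply, h.length, hD]
    have e1 : σ'.nat 1 0 = n := by simp [hF.nat 1 (by decide), write_apply, h1]
    have e4 : σ'.nat 4 0 = 2 ^ r := by simp [hF.nat 4 (by decide), write_apply, h.size]
    refine Runs.nsetThen (D * 100 + 40) ?_ (by simp only [NExp.cost]; omega)
    refine Runs.andThen (D * 100 + 15) 20 ((Runs.forLoop (B := 80) D (fun j σ'' =>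
      σ''.nat 12 0 = j % n ∧ σ''.nat 11 0 = i * D + j ∧
        ∀ s < (i + 1) * D + j, (σ''.nat 7 s : ZMod 2) = pointVal coins n r (s / n) (s % n))
      ⟨?_, ?_, ?_⟩ ?_ (by decide) ?_).weaken ?_) ?_ (by omega)
    · simp [write_apply, NExp.eval]
    · simp [write_apply, NExp.eval, h11]
    · intro s hs
      simp [write_apply, NExp.eval, h7 s (by omega)]
    · intro j hj σ'' _ hF'
      simp [NExp.eval, hF'.nat 13 (by decide), write_apply, e13]
    · rintro j hj σ'' ⟨h12, h11', h7'⟩ hF' h8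
      have f13 : σ''.nat 13 0 = D := by simp [hF'.nat 13 (by decide), write_apply, e13]
      have f1 : σ''.nat 1 0 = n := by simp [hF'.nat 1 (by decide), write_apply, e1]
      have f9 : σ''.nat 9 0 = i := by simp [hF'.nat 9 (by decide), write_apply, h9]
      refine Runs.nsetThen 50 ?_ (by simp [NExp.cost])
      refine Runs.nsetThen 30 ?_ (by simp [NExp.cost])
      refine (runs_advanceColumn (s := j) hn ?_ ?_ ⟨?_, ?_, ?_⟩).weaken (by norm_num)
      · simp [write_apply, NExp.eval, f1]
      · simp [write_apply, NExp.eval, h12]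
      · simp [write_apply]
      · simp [write_apply, NExp.eval, h11', add_assoc]
      · intro s hs
        simp only [write_apply, NExp.eval, f13, f9, h12, h11']
        rcases eq_or_ne s (i * D + j + D) with rfl | hne
        · have h7i := h7' (i * D + j) (by nlinarith)
          have hmod : ∀ x, (x * D + j) % n = j % n := fun x => by
            rw [Nat.add_mod, hDn, zero_add, Nat.mod_mod]
          have hdiv : ∀ x, (x * D + j) / n = x * 2 ^ r + j / n := fun x => by
            rw [hD, ← mul_assoc, add_comm, Nat.add_mul_div_right _ _ hn, add_comm]
          have hjd : j / n < 2 ^ r := Nat.div_lt_of_lt_mul (by rwa [mul_comm])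
          have hq : ∀ x, (x * 2 ^ r + j / n) / 2 ^ r = x := fun x => by
            rw [add_comm, Nat.add_mul_div_right _ _ (by positivity), Nat.div_eq_of_lt hjd,
              zero_add]
          have hm : ∀ x, (x * 2 ^ r + j / n) % 2 ^ r = j / n := fun x => by
            rw [add_comm, Nat.add_mul_mod_self_right, Nat.mod_eq_of_lt hjd]
          have hs' : i * D + j + D = (i + 1) * D + j := by ring
          rw [hs'] at hs ⊢
          rw [hmod, hdiv, pointVal, hq, hm] at h7i ⊢
          simp only [true_and, if_true, show ((7 : ℕ) = 11) = False by simp, false_and, if_false]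
          rw [if_neg (by simp), if_neg (by simp), Nat.cast_add, h7i, add_assoc]
          congr 1
          -- With truncated subtraction, `1 - (x - i) - (i - x)` is the indicator of `x = i`; this
          -- is the coordinate of the added basis vector.
          rcases lt_trichotomy (j % n) i with hlt | heq | hgt
          · rw [if_pos hlt, if_pos (by omega),
              show 1 - (j % n - i) - (i - j % n) = 0 by omega]
            simp
          · rw [if_neg (by omega), if_pos (by omega),
              show 1 - (j % n - i) - (i - j % n) = 1 by omega]
            simp
          · rw [if_neg (by omega), if_neg (by omega),
              show 1 - (j % n - i) - (i - j % n) = 0 by omega]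
            simp
        · have hs2 : i * D + j + D = (i + 1) * D + j := by ring
          simpa [hne] using h7' s (by omega)
    · simp only [NExp.cost]; omega
    · rintro σ'' hF' ⟨-, h11', h7'⟩
      have f4 : σ''.nat 4 0 = 2 ^ r := by simp [hF'.nat 4 (by decide), write_apply, e4]
      have f14 : σ''.nat 14 0 = (i + 1) * 2 ^ r := by
        simp [hF'.nat 14 (by decide), write_apply, h14]
      refine Runs.weaken (Runs.nset ⟨?_, ?_, ?_⟩) (by simp [NExp.cost])
      · simp [write_apply, NExp.eval, f4, f14]; ring
      · simp [write_apply, h11']; ring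
      · intro s hs
        simpa [write_apply] using h7' s (by linarith)
  · have : n * (D * 100 + 50 + (1 + 1) + 15) ≤ n * (D * 100 + 100) := Nat.mul_le_mul_left _ (by omega)
    simp only [NExp.cost]; omega
  · rintro σ' - ⟨h14, -, h7⟩
    refine ⟨h14, fun s hs => h7 s ?_⟩
    rwa [hD, ← mul_assoc]

/-! ### The number of repetitions -/

/-- The logarithm of the number of points. -/
def logPoints (k n : ℕ) : ℕ := Nat.clog 2 (numPoints k n)

/-- The number of repetitions of each query. -/
def reps (k n : ℕ) (δ : ℝ) : ℕ := ⌈logPoints k n / (δ * δ)⌉₊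

/-- Compute the logarithm of the number of points and the number of repetitions. -/
def computeReps : Prog :=
  .seq (assign 15 (.const 0)) <|
  .seq (assign 16 (.const 1)) <|
  .seq (.loop (.not (.nle (rd 14) (rd 16)))
    (.seq (assign 16 (.add (rd 16) (rd 16))) (assign 15 (.add (rd 15) (.const 1))))) <|
  .seq (assign 17 (.const 0))
    (.loop (.not (.rle (.ofNat (rd 15))
      (.mul (.ofNat (rd 17)) (.mul (.read 1 (.const 0)) (.read 1 (.const 0))))))
      (assign 17 (.add (rd 17) (.const 1))))

/-- Both numbers are found by linear search: `Nat.clog` as the first exponent whose power of two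
reaches the number of points, and the ceiling as the first `c` with `logPoints k n ≤ c * (δ * δ)`,
which avoids rounding a real number. -/
theorem runs_computeReps {σ : State n} {k : ℕ} {δ : ℝ} (hδ : 0 < δ)
    (h14 : σ.nat 14 0 = numPoints k n) (hr : σ.real 1 0 = δ) :
    Runs coins answers computeReps σ (50 * logPoints k n + 50 * reps k n δ + 100)
      (fun σ' => σ'.nat 17 0 = reps k n δ) := by
  rw [computeReps]
  refine Runs.nsetThen (50 * logPoints k n + 50 * reps k n δ + 90) ?_
    (by simp only [NExp.cost]; omega)
  refine Runs.nsetThen (50 * logPoints k n + 50 * reps k n δ + 80) ?_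
    (by simp only [NExp.cost]; omega)
  refine Runs.andThen (50 * logPoints k n + 20) (50 * reps k n δ + 50)
    ((Runs.loop (B := 20) (logPoints k n) (fun i σ' => σ'.nat 15 0 = i ∧ σ'.nat 16 0 = 2 ^ i)
      ?_ ?_ ?_).weaken ?_) ?_ (by omega)
  · simp [write_apply, NExp.eval]
  · rintro i hi σ' ⟨h15, h16⟩ hF
    have e14 : σ'.nat 14 0 = numPoints k n := by simp [hF.nat 14 (by decide), write_apply, h14]
    simp [BExp.Holds, NExp.eval, e14, h16, logPoints, Nat.lt_clog_iff_pow_lt]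
  · rintro i hi σ' ⟨h15, h16⟩ hF
    refine Runs.weaken (Runs.seq (Runs.nset (Runs.nset ⟨?_, ?_⟩))) (by simp [NExp.cost])
    · simp [write_apply, NExp.eval, h15]
    · simp [write_apply, NExp.eval, h16]; ring
  · simp [BExp.cost, NExp.cost]; omega
  · rintro σ' hF ⟨h15, -⟩
    have e1 : σ'.real 1 0 = δ := by simp [hF.real 1 (by decide), hr]
    refine Runs.nsetThen (50 * reps k n δ + 40) ?_ (by simp only [NExp.cost]; omega)
    refine (Runs.loop (B := 20) (reps k n δ) (fun i σ' => σ'.nat 17 0 = i) ?_ ?_ ?_).weaken ?_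
    · simp [write_apply, NExp.eval]
    · rintro i hi σ'' h17 hF'
      have f15 : σ''.nat 15 0 = logPoints k n := by
        simp [hF'.nat 15 (by decide), write_apply, h15]
      have f1 : σ''.real 1 0 = δ := by simp [hF'.real 1 (by decide), e1]
      simp only [BExp.Holds, RExp.eval, NExp.eval, f15, f1, h17, not_le, reps, Nat.lt_ceil]
      rw [lt_div_iff₀ (by positivity)]
    · rintro i hi σ'' h17 hF'
      refine Runs.weaken (Runs.nset ?_) (by simp [NExp.cost])
      simp [write_apply, NExp.eval, h17]
    · simp [BExp.cost, NExp.cost, RExp.cost]; omega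

end

section

variable {n : ℕ} {coins : ℕ → Bool} {answers : ℕ → ℂ}

/-! ### Medians -/

/-- `y` is a median of `a 0, …, a (m - 1)`. -/
def IsMedian (m : ℕ) (a : ℕ → ℝ) (y : ℝ) : Prop :=
  m ≤ 2 * Nat.count (fun q => a q ≤ y) m ∧ m ≤ 2 * Nat.count (fun q => y ≤ a q) m

theorem count_add_count_not (p : ℕ → Prop) [DecidablePred p] (m : ℕ) :
    Nat.count p m + Nat.count (fun q => ¬ p q) m = m := by
  induction m with
  | zero => simp
  | succ m ih =>
    rw [Nat.count_succ, Nat.count_succ]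
    by_cases h : p m <;> simp [h] <;> omega

theorem count_mono {p q : ℕ → Prop} [DecidablePred p] [DecidablePred q] {m : ℕ}
    (h : ∀ i < m, p i → q i) : Nat.count p m ≤ Nat.count q m := by
  rw [Nat.count_eq_card_filter_range, Nat.count_eq_card_filter_range]
  refine Finset.card_le_card fun i hi => ?_
  simp only [Finset.mem_filter, Finset.mem_range] at hi ⊢
  exact ⟨hi.1, h i hi.1 hi.2⟩

/-- One of the numbers is a median. -/
theorem exists_isMedian {m : ℕ} (hm : 0 < m) (a : ℕ → ℝ) : ∃ q < m, IsMedian m a (a q) := by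
  -- Take the smallest value that at least half of the numbers do not exceed. If fewer than half
  -- were at least this large, the largest value strictly below it would still belong to `G`.
  set G := (Finset.range m).filter fun q => m ≤ 2 * Nat.count (fun i => a i ≤ a q) m with hG
  have hne : G.Nonempty := by
    obtain ⟨q, hq, hmax⟩ := (Finset.range m).exists_max_image a ⟨0, by simpa⟩
    refine ⟨q, Finset.mem_filter.2 ⟨hq, ?_⟩⟩
    have : Nat.count (fun i => a i ≤ a q) m = m := by
      rw [Nat.count_eq_card_filter_range, Finset.filter_true_of_mem hmax, Finset.card_range]
    omega
  obtain ⟨q, hq, hmin⟩ := G.exists_min_image a hne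
  obtain ⟨hqm, hq'⟩ := Finset.mem_filter.1 hq
  refine ⟨q, Finset.mem_range.1 hqm, hq', ?_⟩
  by_contra! hlt
  have h1 := count_add_count_not (fun i => a q ≤ a i) m
  have hne' : ((Finset.range m).filter fun i => a i < a q).Nonempty := by
    by_contra hemp
    rw [Finset.not_nonempty_iff_eq_empty, Finset.filter_eq_empty_iff] at hemp
    have : Nat.count (fun i => a q ≤ a i) m = m := by
      rw [Nat.count_eq_card_filter_range, Finset.filter_true_of_mem
        (fun i hi => not_lt.1 (hemp hi)), Finset.card_range]
    omega
  obtain ⟨j, hj, hjmax⟩ := Finset.exists_max_image _ a hne'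
  simp only [Finset.mem_filter, Finset.mem_range] at hj hjmax
  have h2 : Nat.count (fun i => ¬ a q ≤ a i) m ≤ Nat.count (fun i => a i ≤ a j) m :=
    count_mono fun i hi h => hjmax i ⟨hi, not_le.1 h⟩
  have hjG : j ∈ G := Finset.mem_filter.2 ⟨Finset.mem_range.2 hj.1, by omega⟩
  exact absurd hj.2 (not_lt.2 (hmin j hjG))

/-- If more than half of the numbers lie in an interval, so does the median. -/
theorem IsMedian.abs_sub_le {m : ℕ} {a : ℕ → ℝ} {y c ε : ℝ} (h : IsMedian m a y)
    {bad : ℕ → Prop} [DecidablePred bad] (hbad : 2 * Nat.count bad m < m)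
    (hgood : ∀ i < m, ¬ bad i → |a i - c| ≤ ε) : |y - c| ≤ ε := by
  rw [abs_le]
  constructor
  -- If the median lay below the interval, every index counted on its lower side would be bad, yet
  -- these are at least half of all indices. The other side is symmetric.
  · by_contra! hlt
    have : Nat.count (fun i => a i ≤ y) m ≤ Nat.count bad m := count_mono fun i hi hy => by
      by_contra hb
      have := (abs_le.1 (hgood i hi hb)).1
      linarith
    have := h.1
    omega
  · by_contra! hlt
    have : Nat.count (fun i => y ≤ a i) m ≤ Nat.count bad m := count_mono fun i hi hy => by
      by_contra hb
      have := (abs_le.1 (hgood i hi hb)).2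
      linarith
    have := h.2
    omega

/-- The answer with the index that is stored in the variable `v`; the parameter `c` selects the
real or the imaginary part. -/
abbrev answerPart (c v : ℕ) : RExp := .read 4 (.add (.add (rd v) (rd v)) (.const c))

/-- Write the median of the buffered answers to the array `5`. -/
def medianAt (c : ℕ) (dst : NExp) : Prog :=
  forLoop 20 (rd 17) <|
    .seq (assign 22 (.const 0)) <|
    .seq (assign 23 (.const 0)) <|
    .seq (forLoop 21 (rd 17) (.seq
      (.cond (.rle (answerPart c 21) (answerPart c 20)) (assign 22 (.add (rd 22) (.const 1))) .skip)
      (.cond (.rle (answerPart c 20) (answerPart c 21))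
        (assign 23 (.add (rd 23) (.const 1))) .skip)))
    (.cond (.nle (rd 17) (.add (rd 22) (rd 22)))
      (.cond (.nle (rd 17) (.add (rd 23) (rd 23))) (.rset 5 dst (answerPart c 20)) .skip) .skip)

/-- Every buffered value is tested by counting, without sorting, and each one that passes is
written. The invariant says that a median is in place or none of the values tried so far is one;
`exists_isMedian` excludes the second case at the end. The hypothesis on `dst` states that it
depends only on arrays the loop leaves alone. -/
theorem runs_medianAt {σ : State n} {m c d : ℕ} {dst : NExp} (hm : 0 < m) (h17 : σ.nat 17 0 = m)
    (hd : ∀ σ' : State n, σ'.nat 18 = σ.nat 18 → σ'.nat 14 = σ.nat 14 → dst.eval σ' = d) :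
    Runs coins answers (medianAt c dst) σ (m * (m * 120 + 200 + dst.cost) + 20)
      (fun σ' => ∃ y, IsMedian m (fun q => σ.real 4 (q + q + c)) y ∧
        σ'.real 5 = Function.update (σ.real 5) d y) := by
  set a : ℕ → ℝ := fun q => σ.real 4 (q + q + c) with ha
  refine (Runs.forLoop (B := m * 120 + 170 + dst.cost) m (fun i σ' =>
    (∃ y, IsMedian m a y ∧ σ'.real 5 = Function.update (σ.real 5) d y) ∨
      (σ'.real 5 = σ.real 5 ∧ ∀ q < i, ¬ IsMedian m a (a q))) ?_ ?_ ?_ ?_).mono ?_ ?_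
  · exact Or.inr ⟨rfl, by simp⟩
  · intro i hi σ' _ hF
    simp [NExp.eval, hF.nat 17 (by simp [forLoop, Prog.nats]), h17]
  · simp [forLoop, Prog.nats]
  · rintro i hi σ' hI hF h20
    have e17 : σ'.nat 17 0 = m := by simp [hF.nat 17 (by simp [forLoop, Prog.nats]), h17]
    have e4 : σ'.real 4 = σ.real 4 := hF.real 4 (by simp [forLoop, Prog.reals])
    have e18 : σ'.nat 18 = σ.nat 18 := hF.nat 18 (by simp [forLoop, Prog.nats])
    have e14 : σ'.nat 14 = σ.nat 14 := hF.nat 14 (by simp [forLoop, Prog.nats])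
    refine Runs.nsetThen (m * 120 + 160 + dst.cost) ?_ (by simp only [NExp.cost]; omega)
    refine Runs.nsetThen (m * 120 + 150 + dst.cost) ?_ (by simp only [NExp.cost]; omega)
    refine Runs.andThen (m * 120 + 20) (100 + dst.cost) ((Runs.forLoop (B := 100) m (fun j σ'' =>
      σ''.nat 22 0 = Nat.count (fun q => a q ≤ a i) j ∧
      σ''.nat 23 0 = Nat.count (fun q => a i ≤ a q) j) ?_ ?_ ?_ ?_).weaken ?_) ?_ (by omega)
    · simp [write_apply, NExp.eval]
    · intro j hj σ'' _ hF'
      simp [NExp.eval, hF'.nat 17 (by simp [forLoop, Prog.nats]), write_apply, e17]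
    · simp [Prog.nats]
    · rintro j hj σ'' ⟨h22, h23⟩ hF' h21
      have f4 : σ''.real 4 = σ.real 4 := (hF'.real 4 (by simp [forLoop, Prog.reals])).trans e4
      have f20 : σ''.nat 20 0 = i := by
        simp [hF'.nat 20 (by simp [forLoop, Prog.nats]), write_apply, h20]
      refine Runs.andThen 45 45
        (Q₁ := fun τ => τ.nat 22 0 = Nat.count (fun q => a q ≤ a i) (j + 1)) ?_ ?_ (by norm_num)
      · refine Runs.weaken (Runs.cond (fun h => Runs.nset ?_) fun h => Runs.skip ?_)
          (by simp [BExp.cost, RExp.cost, NExp.cost])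
        all_goals
          simp only [BExp.Holds, RExp.eval, NExp.eval, h21, f20, f4] at h
          simp [write_apply, NExp.eval, Nat.count_succ, ha, h, h22]
      · intro τ hτ h22'
        have g21 : τ.nat 21 0 = j := by
          simp [hτ.nat 21 (by simp [Prog.nats]), h21]
        have g20 : τ.nat 20 0 = i := by
          simp [hτ.nat 20 (by simp [Prog.nats]), f20]
        have g23 : τ.nat 23 0 = Nat.count (fun q => a i ≤ a q) j := by
          simp [hτ.nat 23 (by simp [Prog.nats]), h23]
        have g4 : τ.real 4 = σ.real 4 := by
          simp [hτ.real 4 (by simp [Prog.reals]), f4]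
        refine Runs.weaken (Runs.cond (fun h => Runs.nset ⟨?_, ?_⟩) fun h => Runs.skip ⟨?_, ?_⟩)
          (by simp [BExp.cost, RExp.cost, NExp.cost])
        all_goals
          simp only [BExp.Holds, RExp.eval, NExp.eval, g21, g20, g4] at h
        · simp [write_apply, NExp.eval, h22']
        · simp [write_apply, NExp.eval, Nat.count_succ, ha, h, g23]
        · simp [write_apply, h22']
        · simp [write_apply, Nat.count_succ, ha, h, g23]
    · simp only [NExp.cost]; omega
    · rintro σ'' hF' ⟨h22, h23⟩
      have f17 : σ''.nat 17 0 = m := by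
        simp [hF'.nat 17 (by simp [forLoop, Prog.nats]), write_apply, e17]
      have f20 : σ''.nat 20 0 = i := by
        simp [hF'.nat 20 (by simp [forLoop, Prog.nats]), write_apply, h20]
      have f4 : σ''.real 4 = σ.real 4 := (hF'.real 4 (by simp [forLoop, Prog.reals])).trans e4
      have f5 : σ''.real 5 = σ'.real 5 := hF'.real 5 (by simp [forLoop, Prog.reals])
      have fd : dst.eval σ'' = d := hd σ''
        (by simp [hF'.nat 18 (by simp [forLoop, Prog.nats]), write_ne, e18])
        (by simp [hF'.nat 14 (by simp [forLoop, Prog.nats]), write_ne, e14])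
      have hno : ¬ IsMedian m a (a i) →
          (∃ y, IsMedian m a y ∧ σ''.real 5 = Function.update (σ.real 5) d y) ∨
            (σ''.real 5 = σ.real 5 ∧ ∀ q < i + 1, ¬ IsMedian m a (a q)) := by
        intro hna
        rw [f5]
        refine hI.imp id fun ⟨h, h'⟩ => ⟨h, fun q hq => ?_⟩
        rcases Nat.lt_succ_iff_lt_or_eq.1 hq with hq | rfl
        exacts [h' q hq, hna]
      refine Runs.weaken (Runs.cond (fun h => Runs.cond (fun h' => Runs.rset (Or.inl ?_))
        fun h' => Runs.skip (hno ?_)) fun h => Runs.skip (hno ?_))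
          (by simp [BExp.cost, RExp.cost, NExp.cost]; omega)
      · simp only [BExp.Holds, NExp.eval, f17, h22, h23] at h h'
        refine ⟨a i, ⟨by omega, by omega⟩, ?_⟩
        simp only [write, fd, NExp.eval, RExp.eval, f20, f4, f5, Function.update_self, ha]
        rcases hI with ⟨y, _, h5⟩ | ⟨h5, _⟩
        · rw [h5, Function.update_idem]
        · rw [h5]
      · simp only [BExp.Holds, NExp.eval, f17, h22, h23] at h h'
        exact fun H => h' (by have := H.2; omega)
      · simp only [BExp.Holds, NExp.eval, f17, h22] at h
        exact fun H => h (by have := H.1; omega)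
  · have : m * (m * 120 + 170 + dst.cost + (rd 17).cost + 15) ≤
        m * (m * 120 + 200 + dst.cost) := Nat.mul_le_mul_left _ (by simp only [NExp.cost]; omega)
    simp only [NExp.cost] at this ⊢; omega
  · rintro σ' - (h | ⟨-, h⟩)
    · exact h
    · obtain ⟨q, hq, hmed⟩ := exists_isMedian hm a
      exact absurd hmed (h q hq)

/-! ### Sampling -/

/-- Query every point repeatedly and store the medians of the answers. -/
def sample : Prog :=
  .seq (assign 19 (.const 0)) <|
  forLoop 18 (rd 14) <|
    .seq (forLoop 20 (rd 17) (.query 7 (rd 19) 4 (.add (rd 20) (rd 20)))) <|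
    .seq (medianAt 0 (rd 18)) <|
    .seq (medianAt 1 (.add (rd 18) (rd 14))) (assign 19 (.add (rd 19) (rd 1)))

/-- The list of the first `j` queries when each point of a list is queried `m` times. -/
def queryList (W : ℕ → ℕ → ℕ) (n m j : ℕ) : List (Cube n) :=
  (List.range j).map fun i => readPoint W 7 (i / m * n)

/-- Query number `P * m + q` is the `q`-th repetition at point `P`. The recorded query list fixes
this numbering, and with it which answer fills which buffer cell. -/
theorem runs_sample {σ : State n} {N m : ℕ} (hm : 0 < m) (h1 : σ.nat 1 0 = n)
    (h14 : σ.nat 14 0 = N) (h17 : σ.nat 17 0 = m) (hq : σ.queries = []) :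
    Runs coins answers sample σ (N * (2 * (m * (m * 120 + n + 300)) + 200) + 30) (fun σ' =>
      σ'.queries = queryList σ.nat n m (N * m) ∧
      ∀ P < N, IsMedian m (fun q => (answers (P * m + q)).re) (σ'.real 5 P) ∧
        IsMedian m (fun q => (answers (P * m + q)).im) (σ'.real 5 (P + N))) := by
  rw [sample]
  set T := m * (m * 120 + n + 300) with hT
  refine Runs.nsetThen (N * (2 * T + 200) + 20) ?_ (by simp only [NExp.cost]; omega)
  refine (Runs.forLoop (B := 2 * T + 160) N (fun i σ' => σ'.nat 19 0 = i * n ∧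
    σ'.queries = queryList σ.nat n m (i * m) ∧
    ∀ P < i, IsMedian m (fun q => (answers (P * m + q)).re) (σ'.real 5 P) ∧
        IsMedian m (fun q => (answers (P * m + q)).im) (σ'.real 5 (P + N)))
    ?_ ?_ (by decide) ?_).mono ?_ ?_
  · simp [write_apply, NExp.eval, hq, queryList]
  · intro i hi σ' _ hF
    simp [NExp.eval, hF.nat 14 (by decide), write_apply, h14]
  · rintro i hi σ' ⟨h19, hqs, hmed⟩ hF h18
    have e14 : σ'.nat 14 0 = N := by simp [hF.nat 14 (by decide), write_apply, h14]
    have e17 : σ'.nat 17 0 = m := by simp [hF.nat 17 (by decide), write_apply, h17]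
    have e1 : σ'.nat 1 0 = n := by simp [hF.nat 1 (by decide), write_apply, h1]
    have e7 : σ'.nat 7 = σ.nat 7 := by simp [hF.nat 7 (by decide), write_ne]
    refine Runs.andThen (m * (n + 50) + 20) (m * (m * 120 + 200 + 2) + m * (m * 120 + 200 + 5) + 100)
      ((Runs.forLoop (B := n + 20) m (fun j τ =>
        τ.queries = queryList σ.nat n m (i * m + j) ∧
        ∀ q < j, τ.real 4 (q + q) = (answers (i * m + q)).re ∧
          τ.real 4 (q + q + 1) = (answers (i * m + q)).im) ?_ ?_ (by decide) ?_).weaken ?_) ?_ ?_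
    · simp [hqs]
    · intro j hj τ _ hF'
      simp [NExp.eval, hF'.nat 17 (by decide), e17]
    · rintro j hj τ ⟨hτq, hτ4⟩ hF' h20
      have f19 : τ.nat 19 0 = i * n := by simp [hF'.nat 19 (by decide), h19]
      have f7 : τ.nat 7 = σ.nat 7 := by simp [hF'.nat 7 (by decide), e7]
      have hlen : τ.queries.length = i * m + j := by simp [hτq, queryList]
      refine Runs.weaken (Runs.query ⟨?_, ?_⟩) (by simp [NExp.cost]; omega)
      · have hdiv : (i * m + j) / m = i := by
          rw [add_comm, Nat.add_mul_div_right _ _ hm, Nat.div_eq_of_lt hj, zero_add]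
        have hpt : readPoint τ.nat 7 (i * n) = (readPoint σ.nat 7 (i * n) : Cube n) := by
          funext l; simp [readPoint, f7]
        simp [queryList, hτq, ← add_assoc, List.range_succ, NExp.eval, f19, hdiv, hpt]
      · intro q hq'
        simp only [write_apply, NExp.eval, h20, hlen]
        rcases eq_or_ne q j with rfl | hne
        · simp
        · have := hτ4 q (by omega)
          have h1 : ¬ q + q = j + j + 1 := by omega
          have h2 : ¬ q + q = j + j := by omega
          have h3 : ¬ q + q + 1 = j + j := by omega
          simp [h1, h2, h3, this]
    · have : m * (n + 20 + (rd 17).cost + 15) ≤ m * (n + 50) :=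
        Nat.mul_le_mul_left _ (by simp only [NExp.cost]; omega)
      simp only [NExp.cost] at this ⊢; omega
    · rintro τ hF' ⟨hτq, hτ4⟩
      have f17 : τ.nat 17 0 = m := by simp [hF'.nat 17 (by decide), e17]
      have f18 : τ.nat 18 0 = i := by simp [hF'.nat 18 (by decide), h18]
      have f14 : τ.nat 14 0 = N := by simp [hF'.nat 14 (by decide), e14]
      have f19 : τ.nat 19 0 = i * n := by simp [hF'.nat 19 (by decide), h19]
      have f1 : τ.nat 1 0 = n := by simp [hF'.nat 1 (by decide), e1]
      have f5 : τ.real 5 = σ'.real 5 := hF'.real 5 (by decide)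
      refine Runs.andThen (m * (m * 120 + 200 + 2) + 20) (m * (m * 120 + 200 + 5) + 70)
        (runs_medianAt hm f17 (d := i) ?_) ?_
        (by omega)
      · intro τ' g18 _
        simp [NExp.eval, g18, f18]
      rintro τ₁ hF₁ ⟨y, hy, hy5⟩
      have g17 : τ₁.nat 17 0 = m := by simp [hF₁.nat 17 (by decide), f17]
      have g18 : τ₁.nat 18 0 = i := by simp [hF₁.nat 18 (by decide), f18]
      have g14 : τ₁.nat 14 0 = N := by simp [hF₁.nat 14 (by decide), f14]
      have g4 : τ₁.real 4 = τ.real 4 := hF₁.real 4 (by decide)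
      refine Runs.andThen (m * (m * 120 + 200 + 5) + 20) 30 (runs_medianAt hm g17 (d := i + N) ?_) ?_
        (by omega)
      · intro τ' g18' g14'
        simp [NExp.eval, g18', g18, g14', g14]
      rintro τ₂ hF₂ ⟨z, hz, hz5⟩
      have k19 : τ₂.nat 19 0 = i * n := by
        simp [hF₂.nat 19 (by decide), hF₁.nat 19 (by decide), f19]
      have k1 : τ₂.nat 1 0 = n := by
        simp [hF₂.nat 1 (by decide), hF₁.nat 1 (by decide), f1]
      have congrMed : ∀ {a b : ℕ → ℝ} {y : ℝ}, (∀ q < m, a q = b q) → IsMedian m a y →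
          IsMedian m b y := by
        intro a b y hab h
        exact ⟨h.1.trans (Nat.mul_le_mul_left _ (count_mono fun q hq => by rw [hab q hq]; exact id)),
          h.2.trans (Nat.mul_le_mul_left _ (count_mono fun q hq => by rw [hab q hq]; exact id))⟩
      refine Runs.weaken (Runs.nset ⟨?_, ?_, fun P hP => ?_⟩) (by simp [NExp.cost])
      · simp [write_apply, NExp.eval, k19, k1]; ring
      · simp only [hF₂.queries (by decide), hF₁.queries (by decide), hτq]
        congr 1; ring
      · simp only [hz5, hy5, f5]
        -- Real medians occupy the indices below `N` and imaginary ones those from `N` on, so the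
        -- two writes at `i` and `i + N` disturb no earlier result.
        rcases eq_or_ne P i with rfl | hne
        · rw [Function.update_of_ne (by omega), Function.update_self, Function.update_self]
          refine ⟨congrMed (fun q hq => (hτ4 q hq).1) hy, congrMed (fun q hq => ?_) hz⟩
          rw [g4]; exact (hτ4 q hq).2
        · rw [Function.update_of_ne (by omega), Function.update_of_ne (by omega),
            Function.update_of_ne (by omega), Function.update_of_ne (by omega)]
          exact hmed P (by omega)
    · have h2 : m * (n + 50) + m * (m * 120 + 200 + 2) ≤ T := by
        rw [← mul_add, hT]; exact Nat.mul_le_mul_left _ (by omega)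
      have h3 : m * (m * 120 + 200 + 5) ≤ T := by
        rw [hT]; exact Nat.mul_le_mul_left _ (by omega)
      omega
  · have : N * (2 * T + 160 + (rd 14).cost + 15) ≤ N * (2 * T + 200) :=
      Nat.mul_le_mul_left _ (by simp only [NExp.cost]; omega)
    simp only [NExp.cost] at this ⊢; omega
  · rintro σ' - ⟨-, h, h'⟩
    exact ⟨h, h'⟩

end

section

variable {n : ℕ} {coins : ℕ → Bool} {answers : ℕ → ℂ}

/-! ### The Walsh–Hadamard transform -/

/-- One stage of the transform of a vector of length `2 * h`. -/
def stage (h : ℕ) (y : ℕ → ℝ) (i : ℕ) : ℝ :=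
  if i < h then y (2 * i) + y (2 * i + 1) else y (2 * (i - h)) - y (2 * (i - h) + 1)

/-- Apply all stages; each stage writes its results behind those of the previous one. -/
def transform : Prog :=
  .seq (assign 11 (.const 0)) <|
  .seq (assign 10 (.add (rd 14) (rd 14))) <|
  forLoop 9 (rd 5) <|
    .seq (forLoop 8 (rd 14) <|
      .seq (.rset 5 (rd 10) (.add (.read 5 (rd 11)) (.read 5 (.add (rd 11) (.const 1))))) <|
      .seq (.rset 5 (.add (rd 10) (rd 14))
        (.sub (.read 5 (rd 11)) (.read 5 (.add (rd 11) (.const 1))))) <|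
      .seq (assign 11 (.add (rd 11) (.const 2))) (assign 10 (.add (rd 10) (.const 1))))
    (assign 10 (.add (rd 10) (rd 14)))

/-- Real and imaginary medians form one vector of length `2 * N`, so a single pass transforms all
translates of both parts at once. Source and target of a stage are disjoint blocks, so no input is
overwritten before it is read. -/
theorem runs_transform {σ : State n} {N r : ℕ} (h14 : σ.nat 14 0 = N) (h5 : σ.nat 5 0 = r) :
    Runs coins answers transform σ (r * (N * 100 + 100) + 50) (fun σ' =>
      σ'.nat 11 0 = r * (2 * N) ∧
      ∀ i < 2 * N, σ'.real 5 (r * (2 * N) + i) = (stage N)^[r] (σ.real 5) i) := by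
  rw [transform]
  set Y : ℕ → ℕ → ℝ := fun s => (stage N)^[s] (σ.real 5) with hY
  have hYs : ∀ s i, Y (s + 1) i = stage N (Y s) i := fun s i => by
    simp only [hY, Function.iterate_succ_apply']
  refine Runs.nsetThen (r * (N * 100 + 100) + 40) ?_ (by simp only [NExp.cost]; omega)
  refine Runs.nsetThen (r * (N * 100 + 100) + 30) ?_ (by simp only [NExp.cost]; omega)
  refine (Runs.forLoop (B := N * 100 + 50) r (fun s σ' => σ'.nat 11 0 = s * (2 * N) ∧
    σ'.nat 10 0 = (s + 1) * (2 * N) ∧ ∀ i < 2 * N, σ'.real 5 (s * (2 * N) + i) = Y s i)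
    ⟨?_, ?_, ?_⟩ ?_ (by decide) ?_).mono ?_ ?_
  · simp [write_apply, NExp.eval]
  · simp [write_apply, NExp.eval, h14]; ring
  · simp [hY]
  · intro i hi σ' _ hF
    simp [NExp.eval, hF.nat 5 (by decide), write_apply, h5]
  · rintro s hs σ' ⟨h11, h10, hA⟩ hF h9
    have e14 : σ'.nat 14 0 = N := by simp [hF.nat 14 (by decide), write_apply, h14]
    refine Runs.andThen (N * 100 + 20) 20 ((Runs.forLoop (B := 80) N (fun j τ =>
      τ.nat 11 0 = s * (2 * N) + 2 * j ∧ τ.nat 10 0 = (s + 1) * (2 * N) + j ∧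
      (∀ i < 2 * N, τ.real 5 (s * (2 * N) + i) = Y s i) ∧
      ∀ i < j, τ.real 5 ((s + 1) * (2 * N) + i) = Y (s + 1) i ∧
        τ.real 5 ((s + 1) * (2 * N) + N + i) = Y (s + 1) (N + i)) ⟨?_, ?_, ?_, ?_⟩ ?_
        (by decide) ?_).weaken ?_) ?_ (by omega)
    · simp [write_apply, h11]
    · simp [write_apply, h10]
    · exact hA
    · simp
    · intro j hj τ _ hF'
      simp [NExp.eval, hF'.nat 14 (by decide), e14]
    · rintro j hj τ ⟨f11, f10, hB, hC⟩ hF' h8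
      have f14 : τ.nat 14 0 = N := by simp [hF'.nat 14 (by decide), e14]
      have hs1 : (s + 1) * (2 * N) = s * (2 * N) + 2 * N := by ring
      have hne : ∀ i < 2 * N, s * (2 * N) + i ≠ (s + 1) * (2 * N) + j := fun i hi => by omega
      have hne' : ∀ i < 2 * N, s * (2 * N) + i ≠ (s + 1) * (2 * N) + j + N := fun i hi => by omega
      have b0 := hB (2 * j) (by omega)
      have b1 := hB (2 * j + 1) (by omega)
      rw [← add_assoc] at b1
      have hlo : Y (s + 1) j = Y s (2 * j) + Y s (2 * j + 1) := by rw [hYs, stage, if_pos hj]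
      have hhi : Y (s + 1) (N + j) = Y s (2 * j) - Y s (2 * j + 1) := by
        rw [hYs, stage, if_neg (by omega), Nat.add_sub_cancel_left]
      refine Runs.weaken (Runs.seq (Runs.rset (Runs.seq (Runs.rset (Runs.seq (Runs.nset (Runs.nset
        ⟨?_, ?_, fun i hi => ?_, fun i hi => ?_⟩))))))) (by simp [NExp.cost, RExp.cost])
      · simp [write_apply, NExp.eval, f11]; ring
      · simp [write_apply, NExp.eval, f10]; ring
      · simp only [write_apply, NExp.eval, f10, f14, hne i hi, hne' i hi, and_false, if_false]
        exact hB i hi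
      · have k1 : s * (2 * N) + 2 * j ≠ (s + 1) * (2 * N) + j := by omega
        have k2 : s * (2 * N) + 2 * j + 1 ≠ (s + 1) * (2 * N) + j := by omega
        simp only [write_apply, NExp.eval, RExp.eval, f10, f11, f14, k1, k2, and_false, if_false,
          true_and]
        rcases eq_or_ne i j with rfl | hij
        · rw [if_neg (by omega), if_pos rfl, if_pos (by omega), b0, b1, hlo, hhi]
          exact ⟨rfl, rfl⟩
        · rw [if_neg (by omega), if_neg (by omega), if_neg (by omega), if_neg (by omega)]
          exact hC i (by omega)
    · simp only [NExp.cost]; omega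
    · rintro τ hF' ⟨f11, f10, hB, hC⟩
      have f14 : τ.nat 14 0 = N := by simp [hF'.nat 14 (by decide), e14]
      refine Runs.weaken (Runs.nset ⟨?_, ?_, fun i hi => ?_⟩) (by simp [NExp.cost])
      · simp [write_apply, f11]; ring
      · simp [write_apply, NExp.eval, f10, f14]; ring
      · rcases lt_or_ge i N with h | h
        · exact (hC i h).1
        · have := (hC (i - N) (by omega)).2
          rwa [show (s + 1) * (2 * N) + N + (i - N) = (s + 1) * (2 * N) + i by omega,
            show N + (i - N) = i by omega] at this
  · have : r * (N * 100 + 50 + (rd 5).cost + 15) ≤ r * (N * 100 + 100) :=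
      Nat.mul_le_mul_left _ (by simp only [NExp.cost]; omega)
    simp only [NExp.cost] at this ⊢; omega
  · rintro σ' - ⟨h, -, h'⟩
    exact ⟨h, h'⟩

/-! ### Reading off the result -/

/-- The `l`-th bit of the frequency in bin `b`: the sign of `C b (l + 1) / C b l`. -/
def decodeBit (C : ℕ → ℕ → ℂ) (b l : ℕ) : ZMod 2 :=
  if 0 ≤ (C b l).re * (C b (l + 1)).re + (C b l).im * (C b (l + 1)).im then 0 else 1

/-- The frequency in bin `b`. -/
def decodeFreq (C : ℕ → ℕ → ℂ) (b : ℕ) : Cube n := fun l => decodeBit C b l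

/-- The bin contains a large coefficient. -/
def Heavy (C : ℕ → ℕ → ℂ) (R : ℕ) (η : ℝ) (b : ℕ) : Prop :=
  (R * η) * (R * η) ≤ 4 * ((C b 0).re * (C b 0).re + (C b 0).im * (C b 0).im)

open Classical in
/-- The function that is recovered from the first `m` bins. -/
def decoded (C : ℕ → ℕ → ℂ) (R : ℕ) (η : ℝ) (m : ℕ) (x : Cube n) : ℂ :=
  ∑ b ∈ (Finset.range m).filter (Heavy C R η),
    (⟨(C b 0).re / R, (C b 0).im / R⟩ : ℂ) * character (decodeFreq C b) x

/-- The entry of the transformed array at the offset `l` of the current bin. -/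
abbrev binRe (l : NExp) : RExp := .read 5 (.add (rd 11) l)

/-- The same for the imaginary part. -/
abbrev binIm (l : NExp) : RExp := .read 5 (.add (.add (rd 11) (.add (rd 1) (.const 1))) l)

theorem output_congr {σ σ' : State n} (h : σ'.nat 2 0 = σ.nat 2 0) (h3 : σ'.nat 3 = σ.nat 3)
    (h2 : σ'.real 2 = σ.real 2) (h3' : σ'.real 3 = σ.real 3) : output σ' = output σ := by
  funext x
  simp only [output, h, h2, h3']
  refine Finset.sum_congr rfl fun j _ => ?_
  congr 2
  funext l
  simp [readPoint, h3]

/-- Append the current bin to the output. -/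
def record : Prog :=
  .seq (forLoop 8 (rd 1) (.seq
    (.cond (.rle (.const 0)
        (.add (.mul (binRe (rd 8)) (binRe (.add (rd 8) (.const 1))))
          (.mul (binIm (rd 8)) (binIm (.add (rd 8) (.const 1))))))
      (.nset 3 (rd 24) (.const 0)) (.nset 3 (rd 24) (.const 1)))
    (assign 24 (.add (rd 24) (.const 1))))) <|
  .seq (.rset 2 (rd 2) (.div (binRe (.const 0)) (.ofNat (rd 4)))) <|
  .seq (.rset 3 (rd 2) (.div (binIm (.const 0)) (.ofNat (rd 4))))
    (assign 2 (.add (rd 2) (.const 1)))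

/-- The running pointer in variable `24` replaces the product `K * n`, which index arithmetic cannot
form. The two indices `l` and `l + 1` in the sign test explain why shifts up to `n` are needed for
`n` bits. -/
theorem runs_record {σ : State n} {R b K : ℕ} {C : ℕ → ℕ → ℂ} (h1 : σ.nat 1 0 = n)
    (h4 : σ.nat 4 0 = R) (h2 : σ.nat 2 0 = K) (h24 : σ.nat 24 0 = K * n)
    (hre : ∀ l ≤ n, σ.real 5 (σ.nat 11 0 + l) = (C b l).re)
    (him : ∀ l ≤ n, σ.real 5 (σ.nat 11 0 + (n + 1) + l) = (C b l).im) :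
    Runs coins answers record σ (n * 120 + 120) (fun σ' =>
      σ'.nat 2 0 = K + 1 ∧ σ'.nat 24 0 = (K + 1) * n ∧ ∀ x, output σ' x = output σ x +
        (⟨(C b 0).re / R, (C b 0).im / R⟩ : ℂ) * character (decodeFreq C b) x) := by
  rw [record]
  refine Runs.andThen (n * 120 + 20) 80 ((Runs.forLoop (B := 100) n (fun l τ =>
    τ.nat 24 0 = K * n + l ∧ (∀ i < K * n, τ.nat 3 i = σ.nat 3 i) ∧
    ∀ i < l, (τ.nat 3 (K * n + i) : ZMod 2) = decodeBit C b i) ⟨?_, ?_, ?_⟩ ?_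
    (by decide) ?_).weaken ?_) ?_ (by omega)
  · simp [write_apply, h24]
  · simp [write_apply]
  · simp
  · intro i hi τ _ hF
    simp [NExp.eval, hF.nat 1 (by decide), h1]
  · rintro l hl τ ⟨f24, hlo, hhi⟩ hF h8
    have f1 : τ.nat 1 0 = n := by simp [hF.nat 1 (by decide), h1]
    have f11 : τ.nat 11 0 = σ.nat 11 0 := by simp [hF.nat 11 (by decide)]
    have f5 : τ.real 5 = σ.real 5 := hF.real 5 (by decide)
    refine Runs.andThen 70 20 (Q₁ := fun τ' => (∀ i < K * n, τ'.nat 3 i = σ.nat 3 i) ∧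
      ∀ i < l + 1, (τ'.nat 3 (K * n + i) : ZMod 2) = decodeBit C b i) ?_ ?_ (by norm_num)
    · have key : ∀ v : ℕ, (v : ZMod 2) = decodeBit C b l →
          (∀ i < K * n, write τ.nat 3 (τ.nat 24 0) v 3 i = σ.nat 3 i) ∧
          ∀ i < l + 1, ((write τ.nat 3 (τ.nat 24 0) v 3 (K * n + i) : ℕ) : ZMod 2) =
            decodeBit C b i := by
        intro v hv
        simp only [write_apply, f24, true_and]
        refine ⟨fun i hi => ?_, fun i hi => ?_⟩
        · rw [if_neg (by omega), hlo i hi]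
        · rcases eq_or_ne i l with rfl | hne
          · rw [if_pos rfl, hv]
          · rw [if_neg (by omega), hhi i (by omega)]
      refine Runs.weaken (Runs.cond (fun h => Runs.nset (key _ ?_)) fun h => Runs.nset (key _ ?_))
        (by simp [BExp.cost, RExp.cost, NExp.cost])
      all_goals
        simp only [BExp.Holds, RExp.eval, NExp.eval, f1, f11, f5, h8, hre l hl.le,
          hre (l + 1) hl, him l hl.le, him (l + 1) hl, Int.cast_zero] at h
        simp [NExp.eval, decodeBit, h]
    · rintro τ' hτ ⟨h, h'⟩
      refine Runs.weaken (Runs.nset ⟨?_, fun i hi => ?_, fun i hi => ?_⟩) (by simp [NExp.cost])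
      · have : τ'.nat 24 0 = K * n + l := by
          simp [hτ.nat 24 (by simp [Prog.nats]), f24]
        simp [write_apply, NExp.eval, this, add_assoc]
      · simp [write_apply, h i hi]
      · simpa [write_apply] using h' i hi
  · simp only [NExp.cost]; omega
  · rintro τ hF ⟨f24, hlo, hhi⟩
    have f1 : τ.nat 1 0 = n := by simp [hF.nat 1 (by decide), h1]
    have f11 : τ.nat 11 0 = σ.nat 11 0 := by simp [hF.nat 11 (by decide)]
    have f2 : τ.nat 2 0 = K := by simp [hF.nat 2 (by decide), h2]
    have f4 : τ.nat 4 0 = R := by simp [hF.nat 4 (by decide), h4]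
    have f5 : τ.real 5 = σ.real 5 := hF.real 5 (by decide)
    have g2 : τ.real 2 = σ.real 2 := hF.real 2 (by decide)
    have g3 : τ.real 3 = σ.real 3 := hF.real 3 (by decide)
    have r0 := hre 0 (Nat.zero_le _)
    have i0 := him 0 (Nat.zero_le _)
    refine Runs.weaken (Runs.seq (Runs.rset (Runs.seq (Runs.rset (Runs.nset
      ⟨?_, ?_, fun x => ?_⟩))))) (by simp [RExp.cost, NExp.cost])
    · simp [write_apply, NExp.eval, f2]
    · simp [write_apply, f24]; ring
    · simp only [output, write_apply, NExp.eval, RExp.eval, f2, h2, and_self, if_true,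
        Finset.sum_range_succ]
      congr 1
      · refine Finset.sum_congr rfl fun j hj => ?_
        have hj := Finset.mem_range.1 hj
        congr 2
        · simp [hj.ne, g2]
        · simp [hj.ne, g3]
        · refine funext fun l => ?_
          -- Frequencies already recorded lie strictly below the write pointer and survive.
          have : j * n + l < K * n := by
            have : (j + 1) * n ≤ K * n := Nat.mul_le_mul_right _ hj
            have := l.2
            nlinarith
          simp [readPoint, write_apply, hlo _ this]
      · congr 2
        · simp only [f11, f4, f5, r0]
          simp
        · simp only [f1, f11, f4, f5, i0]
          simp
        · refine funext fun l => ?_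
          simp [readPoint, write_apply, hhi l l.2, decodeFreq]

/-- Go through all bins and output the heavy ones. -/
def extract : Prog :=
  .seq (assign 24 (.const 0)) <|
  forLoop 9 (rd 4) <|
    .seq (.cond
      (.rle (.mul (.mul (.ofNat (rd 4)) (.read 0 (.const 0)))
          (.mul (.ofNat (rd 4)) (.read 0 (.const 0))))
        (.mul (.const 4) (.add (.mul (binRe (.const 0)) (binRe (.const 0)))
          (.mul (binIm (.const 0)) (binIm (.const 0))))))
      record .skip)
    (assign 11 (.add (rd 11) (.add (.add (rd 1) (.const 1)) (.add (rd 1) (.const 1)))))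

/-- A bin occupies `2 * (n + 1)` consecutive cells, `n + 1` real parts followed by `n + 1` imaginary
parts, which is the amount by which the pointer advances. The heaviness test is squared to avoid
square roots. -/
theorem runs_extract {σ : State n} {R p : ℕ} {η : ℝ} {C : ℕ → ℕ → ℂ} (h1 : σ.nat 1 0 = n)
    (h4 : σ.nat 4 0 = R) (h2 : σ.nat 2 0 = 0) (h0 : σ.real 0 0 = η) (h11 : σ.nat 11 0 = p)
    (hre : ∀ b < R, ∀ l ≤ n, σ.real 5 (p + b * (2 * (n + 1)) + l) = (C b l).re)
    (him : ∀ b < R, ∀ l ≤ n, σ.real 5 (p + b * (2 * (n + 1)) + (n + 1) + l) = (C b l).im) :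
    Runs coins answers extract σ (R * (n * 120 + 300) + 50)
      (fun σ' => ∀ x, output σ' x = decoded C R η R x) := by
  classical
  rw [extract]
  refine Runs.nsetThen (R * (n * 120 + 300) + 30) ?_ (by simp only [NExp.cost]; omega)
  refine (Runs.forLoop (B := n * 120 + 250) R (fun b τ => τ.nat 24 0 = τ.nat 2 0 * n ∧
    τ.nat 11 0 = p + b * (2 * (n + 1)) ∧ ∀ x, output τ x = decoded C R η b x)
    ⟨?_, ?_, fun x => ?_⟩ ?_ (by decide) ?_).mono ?_ ?_
  · simp [write_apply, NExp.eval, h2]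
  · simp [write_apply, h11]
  · simp [output, write_apply, h2, decoded]
  · intro i hi τ _ hF
    simp [NExp.eval, hF.nat 4 (by decide), write_apply, h4]
  · rintro b hb τ ⟨f24, f11, hout⟩ hF h9
    have f1 : τ.nat 1 0 = n := by simp [hF.nat 1 (by decide), write_apply, h1]
    have f4 : τ.nat 4 0 = R := by simp [hF.nat 4 (by decide), write_apply, h4]
    have f0 : τ.real 0 0 = η := by simp [hF.real 0 (by decide), h0]
    have f5 : τ.real 5 = σ.real 5 := hF.real 5 (by decide)
    have r0 := hre b hb 0 (Nat.zero_le _)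
    have i0 := him b hb 0 (Nat.zero_le _)
    refine Runs.andThen (n * 120 + 180) 30 (Q₁ := fun τ' => τ'.nat 24 0 = τ'.nat 2 0 * n ∧
      ∀ x, output τ' x = decoded C R η (b + 1) x) ?_ ?_ (by omega)
    · refine Runs.weaken (Runs.cond (fun h => (runs_record (b := b) (C := C) f1 f4 rfl f24
        (by rw [f11, f5]; exact hre b hb) (by rw [f11, f5]; exact him b hb)).mono le_rfl ?_)
        fun h => Runs.skip ⟨f24, fun x => ?_⟩) (by simp [BExp.cost, RExp.cost, NExp.cost]; omega)
      all_goals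
        simp only [BExp.Holds, RExp.eval, NExp.eval, f1, f11, f5, f4, f0, r0, i0] at h
      · rintro τ' - ⟨k2, k24, kout⟩
        refine ⟨by rw [k24, k2], fun x => ?_⟩
        have hh : Heavy C R η b := by simpa [Heavy] using h
        rw [kout, hout, decoded, decoded, Finset.range_add_one, Finset.filter_insert, if_pos hh,
          Finset.sum_insert (by simp), add_comm]
      · have hh : ¬ Heavy C R η b := by simpa [Heavy] using h
        rw [hout, decoded, decoded, Finset.range_add_one, Finset.filter_insert, if_neg hh]
    · rintro τ' hτ ⟨k24, kout⟩
      have g1 : τ'.nat 1 0 = n := by simp [hτ.nat 1 (by decide), f1]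
      have g11 : τ'.nat 11 0 = p + b * (2 * (n + 1)) := by simp [hτ.nat 11 (by decide), f11]
      refine Runs.weaken (Runs.nset ⟨?_, ?_, fun x => ?_⟩) (by simp [NExp.cost])
      · simp [write_apply, k24]
      · simp [write_apply, NExp.eval, g1, g11]; ring
      · rw [← kout]
        refine congrFun (output_congr ?_ ?_ rfl rfl) x
        · simp [write_apply]
        · simp [write_ne]
  · have : R * (n * 120 + 250 + (rd 4).cost + 15) ≤ R * (n * 120 + 300) :=
      Nat.mul_le_mul_left _ (by have : (rd 4).cost = 2 := rfl; omega)
    have h2 : (rd 4).cost = 2 := rfl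
    omega
  · rintro σ' - ⟨-, -, h⟩
    exact h

end

section

variable {n : ℕ} {coins : ℕ → Bool} {answers : ℕ → ℂ}

/-! ### The algorithm -/

/-- The sparse Fourier transform algorithm. -/
def program : Prog :=
  .seq buildSpan <| .seq buildShifts <| .seq computeReps <| .seq sample <| .seq transform extract

/-- A bound for the number of steps of the algorithm. -/
def stepBound (k n : ℕ) (δ : ℝ) : ℕ :=
  rounds k * (200 * (2 ^ rounds k * n) + 220) + n * (2 ^ rounds k * n * 100 + 100) +
  (50 * logPoints k n + 50 * reps k n δ) +
  numPoints k n * (2 * (reps k n δ * (reps k n δ * 120 + n + 300)) + 200) +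
  rounds k * (numPoints k n * 100 + 100) + 2 ^ rounds k * (n * 120 + 300) + 600

/-- The `P`-th point at which the function is evaluated. -/
def point (coins : ℕ → Bool) (n r P : ℕ) : Cube n := fun l => pointVal coins n r P l

/-- The complex vector in the bin `b` of the transform of `Y`. -/
def bins (n r N : ℕ) (Y : ℕ → ℝ) (b l : ℕ) : ℂ :=
  ⟨(stage N)^[r] Y (b * (2 * (n + 1)) + l), (stage N)^[r] Y (b * (2 * (n + 1)) + (n + 1) + l)⟩

theorem two_le_numPoints (k : ℕ) (hn : 1 ≤ n) : 2 ≤ numPoints k n := by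
  have : 1 ≤ 2 ^ rounds k := Nat.one_le_two_pow
  unfold numPoints
  nlinarith

theorem reps_pos (k : ℕ) {δ : ℝ} (hn : 1 ≤ n) (hδ : 0 < δ) : 0 < reps k n δ := by
  have : 0 < logPoints k n := Nat.clog_pos (by norm_num) (two_le_numPoints k hn)
  rw [reps, Nat.ceil_pos]
  positivity

/-- The list of queries involves the coins but not the answers, so the sampling is nonadaptive. All
that the later analysis needs to know about the answers is that `Y` consists of medians of them. -/
theorem runs_program {k : ℕ} {η δ : ℝ} (hn : 1 ≤ n) (hδ : 0 < δ) :
    Runs coins answers program (initState k n η δ) (stepBound k n δ) (fun σ =>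
      σ.queries = (List.range (numPoints k n * reps k n δ)).map
        (fun j => point coins n (rounds k) (j / reps k n δ)) ∧
      ∃ Y : ℕ → ℝ, (∀ P < numPoints k n,
        IsMedian (reps k n δ) (fun q => (answers (P * reps k n δ + q)).re) (Y P) ∧
        IsMedian (reps k n δ) (fun q => (answers (P * reps k n δ + q)).im)
          (Y (P + numPoints k n))) ∧
        ∀ x, output σ x =
          decoded (bins n (rounds k) (numPoints k n) Y) (2 ^ rounds k) η (2 ^ rounds k) x) := by
  set r := rounds k with hr
  set m := reps k n δ with hm
  set N := numPoints k n with hN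
  have hNr : N = (n + 1) * 2 ^ r := rfl
  have hmpos : 0 < m := reps_pos k hn hδ
  set σ := initState k n η δ with hσ
  have a0 : σ.nat 0 0 = k := by simp [hσ, initState, write_apply]
  have a1 : σ.nat 1 0 = n := by simp [hσ, initState, write_apply]
  have a2 : σ.nat 2 0 = 0 := by simp [hσ, initState, write_apply]
  have a5 : σ.nat 5 0 = 0 := by simp [hσ, initState, write_apply]
  have a7 : ∀ s, σ.nat 7 s = 0 := by simp [hσ, initState, write_apply]
  have b0 : σ.real 0 0 = η := by simp [hσ, initState, write_apply]
  have b1 : σ.real 1 0 = δ := by simp [hσ, initState, write_apply]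
  -- The nonlinear parts of the time bound are made opaque, so that the bookkeeping of budgets
  -- becomes linear arithmetic.
  obtain ⟨T, hT⟩ : ∃ T, T = N * (2 * (m * (m * 120 + n + 300)) + 200) +
    r * (N * 100 + 100) + 2 ^ r * (n * 120 + 300) := ⟨_, rfl⟩
  obtain ⟨T₁, hT₁⟩ : ∃ T, T = r * (200 * (2 ^ r * n) + 220) := ⟨_, rfl⟩
  obtain ⟨T₂, hT₂⟩ : ∃ T, T = n * (2 ^ r * n * 100 + 100) := ⟨_, rfl⟩
  have hB : stepBound k n δ = T₁ + T₂ + (50 * logPoints k n + 50 * m) + T + 600 := by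
    rw [hT, hT₁, hT₂, stepBound]
    ring
  rw [program, hB]
  refine Runs.andThen (T₁ + 40) (T₂ + (50 * logPoints k n + 50 * m) + T + 555)
    (hT₁ ▸ runs_buildSpan hn a0 a1 a5 a7 rfl) ?_ (by omega)
  intro σ₁ h₁ t₁
  have c1 : σ₁.nat 1 0 = n := by simp [h₁.nat 1 (by decide), a1]
  refine Runs.andThen (T₂ + 100) (50 * logPoints k n + 50 * m + T + 450)
    (hT₂ ▸ runs_buildShifts hn c1 t₁) ?_ (by omega)
  rintro σ₂ h₂ ⟨d14, d7⟩
  have d1 : σ₂.nat 1 0 = n := by simp [h₂.nat 1 (by decide), c1]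
  have d4 : σ₂.nat 4 0 = 2 ^ r := by simp [h₂.nat 4 (by decide), t₁.size, hr]
  have d5 : σ₂.nat 5 0 = r := by simp [h₂.nat 5 (by decide), t₁.rounds, hr]
  have d2 : σ₂.nat 2 0 = 0 := by simp [h₂.nat 2 (by decide), h₁.nat 2 (by decide), a2]
  have dr0 : σ₂.real 0 0 = η := by simp [h₂.real 0 (by decide), h₁.real 0 (by decide), b0]
  have dr1 : σ₂.real 1 0 = δ := by simp [h₂.real 1 (by decide), h₁.real 1 (by decide), b1]
  have dq : σ₂.queries = [] := by rw [h₂.queries (by decide), h₁.queries (by decide)]; rfl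
  refine Runs.andThen (50 * logPoints k n + 50 * m + 100) (T + 340)
    (runs_computeReps hδ d14 dr1) ?_ (by omega)
  intro σ₃ h₃ e17
  have e1 : σ₃.nat 1 0 = n := by simp [h₃.nat 1 (by decide), d1]
  have e14 : σ₃.nat 14 0 = N := by simp [h₃.nat 14 (by decide), d14, hNr, hr]
  have eq : σ₃.queries = [] := by rw [h₃.queries (by decide), dq]
  refine Runs.andThen _ (r * (N * 100 + 100) + 2 ^ r * (n * 120 + 300) + 105)
    (runs_sample hmpos e1 e14 e17 eq) ?_ (by rw [hT]; omega)
  rintro σ₄ h₄ ⟨f, fY⟩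
  have f14 : σ₄.nat 14 0 = N := by simp [h₄.nat 14 (by decide), e14]
  have f5 : σ₄.nat 5 0 = r := by simp [h₄.nat 5 (by decide), h₃.nat 5 (by decide), d5]
  refine Runs.andThen _ (2 ^ r * (n * 120 + 300) + 50)
    (runs_transform f14 f5) ?_ (by omega)
  rintro σ₅ h₅ ⟨g11, gA⟩
  have hidx : ∀ b < 2 ^ r, ∀ l < 2 * (n + 1), b * (2 * (n + 1)) + l < 2 * N := by
    intro b hb l hl
    have : (b + 1) * (2 * (n + 1)) ≤ 2 ^ r * (2 * (n + 1)) := Nat.mul_le_mul_right _ hb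
    rw [hNr, show 2 * ((n + 1) * 2 ^ r) = 2 ^ r * (2 * (n + 1)) by ring]
    rw [add_mul, one_mul] at this
    omega
  refine (runs_extract (C := bins n r N (σ₄.real 5)) (R := 2 ^ r) (η := η) ?_ ?_ ?_ ?_ g11
    ?_ ?_).mono le_rfl ?_
  · simp [h₅.nat 1 (by decide), h₄.nat 1 (by decide), e1]
  · simp [h₅.nat 4 (by decide), h₄.nat 4 (by decide), h₃.nat 4 (by decide), d4]
  · simp [h₅.nat 2 (by decide), h₄.nat 2 (by decide), h₃.nat 2 (by decide), d2]
  · simp [h₅.real 0 (by decide), h₄.real 0 (by decide), h₃.real 0 (by decide), dr0]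
  · intro b hb l hl
    rw [add_assoc]
    exact gA _ (hidx b hb l (by omega))
  · intro b hb l hl
    rw [show r * (2 * N) + b * (2 * (n + 1)) + (n + 1) + l =
      r * (2 * N) + (b * (2 * (n + 1)) + ((n + 1) + l)) by ring,
      gA _ (hidx b hb (n + 1 + l) (by omega)), ← add_assoc]
    rfl
  · intro σ₆ h₆ hout
    refine ⟨?_, σ₄.real 5, fY, hout⟩
    rw [h₆.queries (by decide), h₅.queries (by decide), f, queryList]
    refine List.map_congr_left fun j hj => funext fun l => ?_
    have hP : j / m < N := Nat.div_lt_of_lt_mul (by rw [mul_comm]; exact List.mem_range.1 hj)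
    have hlt : j / m * n + l < (n + 1) * 2 ^ r * n := by
      have hl := l.2
      have : (j / m + 1) * n ≤ N * n := Nat.mul_le_mul_right _ hP
      rw [← hNr]
      rw [add_mul, one_mul] at this
      omega
    have hd : (j / m * n + l) / n = j / m := by
      rw [add_comm, Nat.add_mul_div_right _ _ hn, Nat.div_eq_of_lt l.2, zero_add]
    have hmod : (j / m * n + l) % n = l := by
      rw [add_comm, Nat.add_mul_mod_self_right, Nat.mod_eq_of_lt l.2]
    rw [readPoint, h₃.nat 7 (by decide), d7 _ hlt, hd, hmod, point]

end

section

variable {n : ℕ}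

/-! ### Characters of the cube -/

theorem zmod_two_eq_or (a : ZMod 2) : a = 0 ∨ a = 1 := by
  revert a; decide

theorem neg_one_pow_val_add (a b : ZMod 2) :
    (-1 : ℂ) ^ (a + b).val = (-1) ^ a.val * (-1) ^ b.val := by
  rcases zmod_two_eq_or a with rfl | rfl <;> rcases zmod_two_eq_or b with rfl | rfl <;>
    simp [ZMod.val_one, show (1 + 1 : ZMod 2) = 0 from rfl]

theorem neg_one_pow_val_sum {ι : Type*} (s : Finset ι) (a : ι → ZMod 2) :
    (-1 : ℂ) ^ (∑ i ∈ s, a i).val = ∏ i ∈ s, (-1) ^ (a i).val := by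
  classical
  induction s using Finset.induction_on with
  | empty => simp
  | insert i s hi ih => rw [Finset.sum_insert hi, Finset.prod_insert hi, neg_one_pow_val_add, ih]

theorem character_eq_prod (ξ x : Cube n) : character ξ x = ∏ i, (-1) ^ (ξ i * x i).val :=
  neg_one_pow_val_sum _ _

theorem character_add (ξ x y : Cube n) :
    character ξ (x + y) = character ξ x * character ξ y := by
  simp only [character, ← neg_one_pow_val_add, Pi.add_apply, mul_add, Finset.sum_add_distrib]

theorem character_zero (ξ : Cube n) : character ξ 0 = 1 := by simp [character]

theorem character_eq_or (ξ x : Cube n) : character ξ x = 1 ∨ character ξ x = -1 :=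
  neg_one_pow_eq_or ℂ _

theorem norm_character (ξ x : Cube n) : ‖character ξ x‖ = 1 := by
  rcases character_eq_or ξ x with h | h <;> simp [h]

theorem conj_character (ξ x : Cube n) : (starRingEnd ℂ) (character ξ x) = character ξ x := by
  rcases character_eq_or ξ x with h | h <;> simp [h]

theorem sum_neg_one_pow_val (a b : ZMod 2) :
    ∑ c : ZMod 2, (-1 : ℂ) ^ (a * c).val * (-1) ^ (b * c).val = if a = b then 2 else 0 := by
  rw [show (Finset.univ : Finset (ZMod 2)) = {0, 1} from rfl]
  rw [Finset.sum_pair (by decide)]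
  rcases zmod_two_eq_or a with rfl | rfl <;> rcases zmod_two_eq_or b with rfl | rfl <;>
    norm_num [ZMod.val_one]

/-- The sum over the cube factors into sums over single coordinates, and a coordinate where the
frequencies differ contributes zero. -/
theorem sum_character_mul_character (ξ ζ : Cube n) :
    ∑ x, character ξ x * character ζ x = if ξ = ζ then 2 ^ n else 0 := by
  have h := Finset.prod_univ_sum (fun _ : Fin n => (Finset.univ : Finset (ZMod 2)))
    (fun i c => (-1 : ℂ) ^ (ξ i * c).val * (-1) ^ (ζ i * c).val)
  rw [Fintype.piFinset_univ] at h
  simp only [character_eq_prod, ← Finset.prod_mul_distrib, ← h, sum_neg_one_pow_val]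
  split_ifs with heq
  · simp [heq]
  · obtain ⟨i, hi⟩ := Function.ne_iff.1 heq
    exact Finset.prod_eq_zero (Finset.mem_univ i) (by simp [hi])

theorem character_comm (ξ x : Cube n) : character ξ x = character x ξ := by
  simp [character, mul_comm]

theorem complex_two_pow_ne_zero : (2 : ℂ) ^ n ≠ 0 := pow_ne_zero _ two_ne_zero

theorem sum_cubeFourier_mul_character (f : Cube n → ℂ) (x : Cube n) :
    ∑ ξ, cubeFourier f ξ * character ξ x = f x := by
  simp only [cubeFourier, div_mul_eq_mul_div, ← Finset.sum_div, Finset.sum_mul]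
  rw [Finset.sum_comm, div_eq_iff complex_two_pow_ne_zero]
  have : ∀ y, ∑ ξ, f y * character ξ y * character ξ x = if y = x then f x * 2 ^ n else 0 := by
    intro y
    simp only [mul_assoc, ← Finset.mul_sum, character_comm _ y, character_comm _ x]
    rw [sum_character_mul_character]
    split_ifs with h
    · rw [h]
    · simp
  simp [this]

theorem cubeFourier_sum_character (S : Finset (Cube n)) (a : Cube n → ℂ) (ζ : Cube n) :
    cubeFourier (fun x => ∑ ξ ∈ S, a ξ * character ξ x) ζ = if ζ ∈ S then a ζ else 0 := by
  simp only [cubeFourier, Finset.sum_mul]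
  rw [Finset.sum_comm, div_eq_iff complex_two_pow_ne_zero]
  simp only [mul_assoc, ← Finset.mul_sum, sum_character_mul_character]
  simp

/-- Parseval: expand the square and use orthogonality; characters are real, so conjugation fixes
them. -/
theorem sum_norm_sq_sum_character (S : Finset (Cube n)) (a : Cube n → ℂ) :
    ∑ x, ‖∑ ξ ∈ S, a ξ * character ξ x‖ ^ 2 = 2 ^ n * ∑ ξ ∈ S, ‖a ξ‖ ^ 2 := by
  have h : ∀ z : ℂ, ((‖z‖ ^ 2 : ℝ) : ℂ) = z * (starRingEnd ℂ) z := fun z => by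
    rw [Complex.mul_conj']; push_cast; rfl
  rw [← Complex.ofReal_inj]
  push_cast [-Complex.ofReal_pow]
  simp only [h, map_sum, map_mul, conj_character, Finset.sum_mul_sum]
  rw [Finset.sum_comm, Finset.mul_sum]
  refine Finset.sum_congr rfl fun ξ hξ => ?_
  rw [Finset.sum_comm, Finset.sum_eq_single ξ]
  · have := sum_character_mul_character ξ ξ
    rw [if_pos rfl] at this
    push_cast
    rw [← this, Finset.sum_mul]
    refine Finset.sum_congr rfl fun x _ => by ring
  · intro ζ _ hne
    have := sum_character_mul_character ξ ζ
    rw [if_neg (Ne.symm hne)] at this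
    calc _ = a ξ * (starRingEnd ℂ) (a ζ) * ∑ x, character ξ x * character ζ x := by
          rw [Finset.mul_sum]
          exact Finset.sum_congr rfl fun x _ => by ring
      _ = 0 := by rw [this, mul_zero]
  · exact fun h => absurd hξ h

/-- Cauchy–Schwarz bounds the `L¹` mean by the `L²` mean, which Parseval evaluates. -/
theorem meanAbs_sum_character_le (S : Finset (Cube n)) (a : Cube n → ℂ) {B : ℝ} (hB : 0 ≤ B)
    (h : ∑ ξ ∈ S, ‖a ξ‖ ^ 2 ≤ B ^ 2) :
    meanAbs (fun x => ∑ ξ ∈ S, a ξ * character ξ x) ≤ B := by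
  have hcs := sq_sum_le_card_mul_sum_sq (s := (Finset.univ : Finset (Cube n)))
    (f := fun x => ‖∑ ξ ∈ S, a ξ * character ξ x‖)
  rw [sum_norm_sq_sum_character] at hcs
  have hcard : ((Finset.univ : Finset (Cube n)).card : ℝ) = 2 ^ n := by
    simp [ZMod.card]
  rw [hcard] at hcs
  rw [meanAbs, div_le_iff₀ (by positivity)]
  refine le_of_sq_le_sq ?_ (by positivity)
  calc _ ≤ _ := hcs
    _ ≤ (2 : ℝ) ^ n * (2 ^ n * B ^ 2) := by gcongr
    _ = _ := by ring

/-! ### The Hadamard matrix -/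

/-- The entries of the Hadamard matrix of size `2 ^ t`. -/
def sgn : ℕ → ℕ → ℕ → ℝ
  | 0, _, _ => 1
  | t + 1, u, b => sgn t (u % 2 ^ t) (b % 2 ^ t) * if 2 ^ t ≤ u ∧ 2 ^ t ≤ b then -1 else 1

/-- This and the next four rules spell out the block form `[[H, H], [H, -H]]` of the matrix of size
`2^(t+1)`. -/
theorem sgn_lo {t u b : ℕ} (hu : u < 2 ^ t) :
    sgn (t + 1) u b = sgn t u (b % 2 ^ t) := by
  rw [sgn, Nat.mod_eq_of_lt hu, if_neg (by omega), mul_one]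

theorem sgn_hi_lo {t u b : ℕ} (hu : u < 2 ^ t) (hb : b < 2 ^ t) :
    sgn (t + 1) (2 ^ t + u) b = sgn t u b := by
  rw [sgn, Nat.add_mod_left, Nat.mod_eq_of_lt hu, Nat.mod_eq_of_lt hb, if_neg (by omega), mul_one]

theorem sgn_hi_hi {t u b : ℕ} (hu : u < 2 ^ t) (hb : b < 2 ^ t) :
    sgn (t + 1) (2 ^ t + u) (2 ^ t + b) = -sgn t u b := by
  rw [sgn, Nat.add_mod_left, Nat.mod_eq_of_lt hu, Nat.add_mod_left, Nat.mod_eq_of_lt hb,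
    if_pos ⟨by omega, by omega⟩, mul_neg_one]

theorem sgn_lo_lo {t u b : ℕ} (hu : u < 2 ^ t) (hb : b < 2 ^ t) :
    sgn (t + 1) u b = sgn t u b := by
  rw [sgn_lo hu, Nat.mod_eq_of_lt hb]

theorem sgn_lo_hi {t u b : ℕ} (hu : u < 2 ^ t) (hb : b < 2 ^ t) :
    sgn (t + 1) u (2 ^ t + b) = sgn t u b := by
  rw [sgn_lo hu, Nat.add_mod_left, Nat.mod_eq_of_lt hb]

theorem sum_range_two_pow_succ {α : Type*} [AddCommMonoid α] (t : ℕ) (g : ℕ → α) :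
    ∑ u ∈ Finset.range (2 ^ (t + 1)), g u =
      ∑ u ∈ Finset.range (2 ^ t), g u + ∑ u ∈ Finset.range (2 ^ t), g (2 ^ t + u) := by
  rw [pow_succ, mul_two, Finset.sum_range_add]

/-- The Walsh–Hadamard transform. -/
def hadamard (t : ℕ) (e : ℕ → ℝ) (b : ℕ) : ℝ := ∑ u ∈ Finset.range (2 ^ t), e u * sgn t u b

/-- The two halves of the butterfly: sums for the low bins, differences for the high ones, exactly
as in `stage`. -/
theorem hadamard_succ_lo {t b : ℕ} (hb : b < 2 ^ t) (e : ℕ → ℝ) :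
    hadamard (t + 1) e b = hadamard t e b + hadamard t (fun u => e (2 ^ t + u)) b := by
  rw [hadamard, sum_range_two_pow_succ]
  congr 1 <;> refine Finset.sum_congr rfl fun u hu => ?_
  · rw [sgn_lo_lo (Finset.mem_range.1 hu) hb]
  · rw [sgn_hi_lo (Finset.mem_range.1 hu) hb]

theorem hadamard_succ_hi {t b : ℕ} (hb : b < 2 ^ t) (e : ℕ → ℝ) :
    hadamard (t + 1) e (2 ^ t + b) = hadamard t e b - hadamard t (fun u => e (2 ^ t + u)) b := by
  rw [hadamard, sum_range_two_pow_succ, sub_eq_add_neg, hadamard, hadamard,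
    ← Finset.sum_neg_distrib]
  congr 1 <;> refine Finset.sum_congr rfl fun u hu => ?_
  · rw [sgn_lo_hi (Finset.mem_range.1 hu) hb]
  · rw [sgn_hi_hi (Finset.mem_range.1 hu) hb, mul_neg]

/-- Each butterfly doubles the sum of squares, by the parallelogram identity `(x + y)² + (x - y)² =
2x² + 2y²`. -/
theorem sum_hadamard_sq (t : ℕ) (e : ℕ → ℝ) :
    ∑ b ∈ Finset.range (2 ^ t), hadamard t e b ^ 2 =
      2 ^ t * ∑ u ∈ Finset.range (2 ^ t), e u ^ 2 := by
  induction t generalizing e with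
  | zero => simp [hadamard, sgn]
  | succ t ih =>
    rw [sum_range_two_pow_succ, sum_range_two_pow_succ]
    have h1 := ih e
    have h2 := ih fun u => e (2 ^ t + u)
    calc _ = ∑ b ∈ Finset.range (2 ^ t), (2 * hadamard t e b ^ 2 +
          2 * hadamard t (fun u => e (2 ^ t + u)) b ^ 2) := by
          rw [← Finset.sum_add_distrib]
          refine Finset.sum_congr rfl fun b hb => ?_
          rw [hadamard_succ_lo (Finset.mem_range.1 hb), hadamard_succ_hi (Finset.mem_range.1 hb)]
          ring
      _ = _ := by
          rw [Finset.sum_add_distrib, ← Finset.mul_sum, ← Finset.mul_sum, h1, h2, pow_succ]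
          ring

/-- Orthogonality of the Hadamard matrix, block by block: contributions of the two halves double
when the top digits of `b` and `b'` agree and cancel otherwise. -/
theorem hadamard_sgn {t b b' : ℕ} (hb : b < 2 ^ t) (hb' : b' < 2 ^ t) :
    hadamard t (fun u => sgn t u b') b = if b' = b then 2 ^ t else 0 := by
  induction t generalizing b b' with
  | zero =>
    have : b' = b := by omega
    simp [hadamard, sgn, this]
  | succ t ih =>
    have hcongr : ∀ {g h : ℕ → ℝ} {c : ℕ}, (∀ u < 2 ^ t, g u = h u) →
        hadamard t g c = hadamard t h c := fun hgh =>
      Finset.sum_congr rfl fun u hu => by rw [hgh u (Finset.mem_range.1 hu)]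
    have hneg : ∀ {g : ℕ → ℝ} {c : ℕ}, hadamard t (fun u => -g u) c = -hadamard t g c := by
      intro g c; simp [hadamard]
    have split : ∀ c < 2 ^ (t + 1), c < 2 ^ t ∨ ∃ c' < 2 ^ t, c = 2 ^ t + c' := fun c hc => by
      rcases lt_or_ge c (2 ^ t) with h | h
      · exact Or.inl h
      · exact Or.inr ⟨c - 2 ^ t, by rw [pow_succ] at hc; omega, by omega⟩
    rcases split b hb with h | ⟨c, h, rfl⟩ <;> rcases split b' hb' with h' | ⟨c', h', rfl⟩
    · rw [hadamard_succ_lo h, hcongr fun u hu => sgn_lo_lo hu h', hcongr fun u hu => sgn_hi_lo hu h',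
        ih h h']
      split_ifs <;> ring
    · rw [hadamard_succ_lo h, hcongr fun u hu => sgn_lo_hi hu h', hcongr fun u hu => sgn_hi_hi hu h',
        hneg, if_neg (by omega)]
      ring
    · rw [hadamard_succ_hi h, hcongr fun u hu => sgn_lo_lo hu h', hcongr fun u hu => sgn_hi_lo hu h',
        if_neg (by omega)]
      ring
    · rw [hadamard_succ_hi h, hcongr fun u hu => sgn_lo_hi hu h', hcongr fun u hu => sgn_hi_hi hu h',
        hneg, ih h h']
      simp only [Nat.add_left_cancel_iff]
      split_ifs <;> ring

/-- The stages compute the Hadamard transform of every block. -/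
theorem iterate_stage (Y : ℕ → ℝ) (N t : ℕ) {D b w : ℕ} (hD : 2 * N = D * 2 ^ t) (hb : b < 2 ^ t)
    (hw : w < D) :
    (stage N)^[t] Y (b * D + w) = hadamard t (fun u => Y (w * 2 ^ t + u)) b := by
  -- The layout is transposed along the way: after `t` stages the bin number `b` is the outer index
  -- and the block number `w` the inner one. The induction hypothesis is used with twice as many
  -- blocks of half the length, the two halves of block `w` being blocks `2w` and `2w + 1`.
  induction t generalizing D b w with
  | zero =>
    obtain rfl : b = 0 := by simpa using hb
    simp [hadamard, sgn]
  | succ t ih =>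
    have hD2 : 2 * N = 2 * D * 2 ^ t := by rw [hD]; ring
    have hN : N = D * 2 ^ t := by
      rw [pow_succ] at hD; linarith
    have e0 : ∀ c < 2 ^ t, (stage N)^[t] Y (2 * (c * D + w)) =
        hadamard t (fun u => Y (w * 2 ^ (t + 1) + u)) c := fun c hc => by
      rw [show 2 * (c * D + w) = c * (2 * D) + 2 * w by ring, ih hD2 hc (by omega)]
      refine congrFun (congrArg _ (funext fun u => ?_)) _
      congr 1; ring
    have e1 : ∀ c < 2 ^ t, (stage N)^[t] Y (2 * (c * D + w) + 1) =
        hadamard t (fun u => Y (w * 2 ^ (t + 1) + (2 ^ t + u))) c := fun c hc => by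
      rw [show 2 * (c * D + w) + 1 = c * (2 * D) + (2 * w + 1) by ring, ih hD2 hc (by omega)]
      refine congrFun (congrArg _ (funext fun u => ?_)) _
      congr 1; ring
    rw [Function.iterate_succ_apply', stage]
    rcases lt_or_ge b (2 ^ t) with h | h
    · have : b * D + w < N := by rw [hN]; nlinarith
      rw [if_pos this, e0 b h, e1 b h, hadamard_succ_lo h]
    · obtain ⟨c, rfl⟩ := Nat.exists_eq_add_of_le h
      have hc : c < 2 ^ t := by rw [pow_succ] at hb; omega
      have hidx : (2 ^ t + c) * D + w = N + (c * D + w) := by rw [hN]; ring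
      rw [hidx, if_neg (by omega), Nat.add_sub_cancel_left, e0 c hc, e1 c hc, hadamard_succ_hi hc]

end

section

variable {n : ℕ}

/-! ### Hashing frequencies into bins -/

/-- The inner product of a frequency with the `t`-th random vector. -/
def hashBit (v : ℕ → ℕ → ZMod 2) (ξ : Cube n) (t : ℕ) : ZMod 2 := ∑ i, ξ i * v t i

/-- The bin of a frequency: its inner products with the first `t` vectors, as binary digits. -/
def hash (v : ℕ → ℕ → ZMod 2) (ξ : Cube n) : ℕ → ℕ
  | 0 => 0
  | t + 1 => if hashBit v ξ t = 0 then hash v ξ t else 2 ^ t + hash v ξ t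

theorem hash_lt (v : ℕ → ℕ → ZMod 2) (ξ : Cube n) (t : ℕ) : hash v ξ t < 2 ^ t := by
  induction t with
  | zero => simp [hash]
  | succ t ih => rw [hash, pow_succ]; split_ifs <;> omega

/-- The hash value determines its binary digits; compare the top digit and recurse. -/
theorem hashBit_eq_of_hash_eq {v : ℕ → ℕ → ZMod 2} {ξ ζ : Cube n} {t : ℕ}
    (h : hash v ξ t = hash v ζ t) : ∀ s < t, hashBit v ξ s = hashBit v ζ s := by
  induction t with
  | zero => simp
  | succ t ih =>
    have h1 := hash_lt v ξ t
    have h2 := hash_lt v ζ t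
    rw [hash, hash] at h
    have key : hash v ξ t = hash v ζ t ∧ hashBit v ξ t = hashBit v ζ t := by
      rcases zmod_two_eq_or (hashBit v ξ t) with a | a <;>
        rcases zmod_two_eq_or (hashBit v ζ t) with b | b <;> simp only [a, b] at h ⊢ <;>
        simp at h ⊢ <;> omega
    intro s hs
    rcases Nat.lt_succ_iff_lt_or_eq.1 hs with hs | rfl
    exacts [ih key.1 s hs, key.2]

/-- This identifies subsampling with the Hadamard transform. Both sides satisfy the same recursion:
a top digit `1` of `u` adds the vector `v t`, which multiplies the character by `-1` exactly when
the top digit of the hash is `1`. -/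
theorem character_spanVal (v : ℕ → ℕ → ZMod 2) (ξ : Cube n) {t u : ℕ} (hu : u < 2 ^ t) :
    character ξ (fun l => spanVal v t u l) = (sgn t u (hash v ξ t) : ℝ) := by
  induction t generalizing u with
  | zero =>
    have : (fun l : Fin n => spanVal v 0 u l) = 0 := rfl
    rw [this, character_zero]
    simp [sgn]
  | succ t ih =>
    have hv : character ξ (fun l => v t l) = (-1) ^ (hashBit v ξ t).val := rfl
    have hh := hash_lt v ξ t
    rcases lt_or_ge u (2 ^ t) with h | h
    · have : (fun l : Fin n => spanVal v (t + 1) u l) = fun l : Fin n => spanVal v t u l := by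
        funext l; rw [spanVal, if_pos h]
      rw [this, ih h, hash]
      split_ifs
      · rw [sgn_lo_lo h hh]
      · rw [sgn_lo_hi h hh]
    · obtain ⟨w, rfl⟩ := Nat.exists_eq_add_of_le h
      have hw : w < 2 ^ t := by rw [pow_succ] at hu; omega
      have : (fun l : Fin n => spanVal v (t + 1) (2 ^ t + w) l) =
          (fun l : Fin n => spanVal v t w l) + fun l : Fin n => v t l := by
        funext l
        rw [spanVal, if_neg (by omega), Nat.add_sub_cancel_left]
        rfl
      rw [this, character_add, ih hw, hv, hash]
      rcases zmod_two_eq_or (hashBit v ξ t) with a | a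
      · rw [if_pos a, sgn_hi_lo hw hh, a]
        simp
      · rw [if_neg (by rw [a]; decide), sgn_hi_hi hw hh, a]
        simp [ZMod.val_one]

/-- The sum of the first `l` standard basis vectors. -/
def prefixVec (n l : ℕ) : Cube n := fun i => if (i : ℕ) < l then 1 else 0

theorem prefixVec_zero : prefixVec n 0 = 0 := by
  funext i; simp [prefixVec]

/-- Consecutive shifts differ by one basis vector, so the ratio of the character values reveals one
bit of the frequency. -/
theorem character_prefixVec_succ (ξ : Cube n) (l : Fin n) :
    character ξ (prefixVec n (l + 1)) = character ξ (prefixVec n l) * (-1) ^ (ξ l).val := by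
  have : prefixVec n (l + 1) = prefixVec n l + Pi.single l 1 := by
    funext i
    simp only [prefixVec, Pi.add_apply]
    rcases lt_trichotomy (i : ℕ) l with h | h | h
    · have hne : i ≠ l := fun e => by simp [e] at h
      simp [hne, h, Nat.lt_succ_of_lt h]
    · have : i = l := Fin.ext h
      simp [this]
    · have hne : i ≠ l := fun e => by simp [e] at h
      simp [hne, h.not_gt, show ¬ (i : ℕ) < l + 1 by omega]
  rw [this, character_add]
  have : (∑ i, ξ i * (Pi.single l 1 : Cube n) i) = ξ l := by simp [Pi.single_apply]
  rw [character.eq_def ξ (Pi.single l 1), this]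

theorem point_eq (coins : ℕ → Bool) (n r l : ℕ) {u : ℕ} (hu : u < 2 ^ r) :
    point coins n r (l * 2 ^ r + u) =
      prefixVec n l + fun i : Fin n => spanVal (coinVec coins n) r u i := by
  funext i
  rw [point, pointVal, add_comm (l * 2 ^ r) u, Nat.add_mul_mod_self_right,
    Nat.add_mul_div_right _ _ (by positivity), Nat.mod_eq_of_lt hu, Nat.div_eq_of_lt hu, zero_add,
    add_comm]
  rfl

/-! ### Correctness of the decoding -/

/-- The measured values at the points with shift `l`. -/
def measured (r N : ℕ) (Y : ℕ → ℝ) (l u : ℕ) : ℂ := ⟨Y (l * 2 ^ r + u), Y (l * 2 ^ r + u + N)⟩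

theorem bins_eq_hadamard (r : ℕ) (Y : ℕ → ℝ) {b l : ℕ} (hb : b < 2 ^ r) (hl : l ≤ n) :
    bins n r ((n + 1) * 2 ^ r) Y b l =
      ∑ u ∈ Finset.range (2 ^ r), measured r ((n + 1) * 2 ^ r) Y l u * (sgn r u b : ℂ) := by
  have hD : 2 * ((n + 1) * 2 ^ r) = 2 * (n + 1) * 2 ^ r := by ring
  have h1 := iterate_stage Y _ r hD hb (w := l) (by omega)
  have h2 := iterate_stage Y _ r hD hb (w := n + 1 + l) (by omega)
  apply Complex.ext
  · simp only [bins, h1, hadamard, Complex.re_sum, Complex.re_mul_ofReal, measured]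
  · simp only [bins, add_assoc _ (n + 1) l, h2, hadamard, Complex.im_sum, Complex.im_mul_ofReal,
      measured]
    refine Finset.sum_congr rfl fun u _ => ?_
    congr 2
    ring

/-- The real inner product is `±‖a‖²` up to cross terms of at most `(1/4 + 1/4 + 1/16) ‖a‖²`, which
cannot change its sign. -/
theorem inner_nonneg_iff {a e e' : ℂ} {s s' : ℂ} {η : ℝ} (hs : s = 1 ∨ s = -1)
    (hs' : s' = 1 ∨ s' = -1) (hη : 0 < η) (ha : η ≤ ‖a‖) (he : ‖e‖ ≤ η / 4) (he' : ‖e'‖ ≤ η / 4) :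
    0 ≤ (a * s + e).re * (a * s' + e').re + (a * s + e).im * (a * s' + e').im ↔ s = s' := by
  have hin : ∀ z w : ℂ, |z.re * w.re + z.im * w.im| ≤ ‖z‖ * ‖w‖ := fun z w => by
    have := abs_real_inner_le_norm z w
    rw [Complex.inner] at this
    simpa [Complex.mul_re, mul_comm] using this
  have h1 := abs_le.1 (hin a e')
  have h2 := abs_le.1 (hin e a)
  have h3 := abs_le.1 (hin e e')
  have hsq : a.re * a.re + a.im * a.im = ‖a‖ * ‖a‖ := by
    rw [← Complex.normSq_apply, Complex.normSq_eq_norm_sq, sq]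
  have b1 : ‖a‖ * ‖e'‖ ≤ ‖a‖ * ‖a‖ / 4 := by nlinarith [norm_nonneg a]
  have b2 : ‖e‖ * ‖a‖ ≤ ‖a‖ * ‖a‖ / 4 := by nlinarith [norm_nonneg a]
  have b3 : ‖e‖ * ‖e'‖ ≤ ‖a‖ * ‖a‖ / 16 := by
    nlinarith [norm_nonneg a, norm_nonneg e, norm_nonneg e']
  have hpos : 0 < ‖a‖ * ‖a‖ := by nlinarith
  have hne : (1 : ℂ) ≠ -1 := by norm_num
  rcases hs with rfl | rfl <;> rcases hs' with rfl | rfl <;>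
    simp only [mul_one, mul_neg, Complex.add_re, Complex.add_im, Complex.neg_re, Complex.neg_im]
  · exact iff_of_true (by nlinarith) trivial
  · exact iff_of_false (by nlinarith) hne
  · exact iff_of_false (by nlinarith) hne.symm
  · exact iff_of_true (by nlinarith) trivial

theorem abs_le_of_norm_sq_le {z : ℂ} {ε η : ℝ} (hη : 0 ≤ η) (hε : ε ^ 2 * 32 ≤ η ^ 2)
    (h : ‖z‖ ^ 2 ≤ 2 * ε ^ 2) : ‖z‖ ≤ η / 4 :=
  le_of_sq_le_sq (by nlinarith) (by positivity)

/-- The deviation of the normalized content of a bin from its ideal value. -/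
def binError (r : ℕ) (E : ℕ → ℂ) (b : ℕ) : ℂ :=
  (∑ u ∈ Finset.range (2 ^ r), E u * (sgn r u b : ℂ)) / 2 ^ r

/-- Parseval for the Hadamard transform: real and imaginary parts contribute at most `ε²` each,
however many bins there are. -/
theorem sum_norm_sq_binError_le (r : ℕ) (E : ℕ → ℂ) {ε : ℝ}
    (hE : ∀ u < 2 ^ r, |(E u).re| ≤ ε ∧ |(E u).im| ≤ ε) :
    ∑ b ∈ Finset.range (2 ^ r), ‖binError r E b‖ ^ 2 ≤ 2 * ε ^ 2 := by
  have hR : (0 : ℝ) < 2 ^ r := by positivity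
  have h : ∀ b, ‖binError r E b‖ ^ 2 = (hadamard r (fun u => (E u).re) b ^ 2 +
      hadamard r (fun u => (E u).im) b ^ 2) / (2 ^ r) ^ 2 := by
    intro b
    rw [binError, norm_div, div_pow, ← Complex.normSq_eq_norm_sq, Complex.normSq_apply]
    simp only [Complex.re_sum, Complex.im_sum, Complex.re_mul_ofReal, Complex.im_mul_ofReal,
      hadamard, norm_pow, Complex.norm_ofNat]
    ring
  have hre : ∀ g : ℕ → ℝ, (∀ u < 2 ^ r, |g u| ≤ ε) →
      ∑ u ∈ Finset.range (2 ^ r), g u ^ 2 ≤ 2 ^ r * ε ^ 2 := by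
    intro g hg
    calc _ ≤ ∑ u ∈ Finset.range (2 ^ r), ε ^ 2 := Finset.sum_le_sum fun u hu =>
          sq_le_sq' (by have := abs_le.1 (hg u (Finset.mem_range.1 hu)); linarith)
            (abs_le.1 (hg u (Finset.mem_range.1 hu))).2
      _ = _ := by simp
  simp only [h]
  rw [← Finset.sum_div, Finset.sum_add_distrib, sum_hadamard_sq, sum_hadamard_sq,
    div_le_iff₀ (by positivity)]
  have h1 := hre _ fun u hu => (hE u hu).1
  have h2 := hre _ fun u hu => (hE u hu).2
  calc _ ≤ (2 : ℝ) ^ r * (2 ^ r * ε ^ 2) + 2 ^ r * (2 ^ r * ε ^ 2) := by gcongr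
    _ = _ := by ring

/-- The deterministic core: separated frequencies together with `ε`-accurate values at all sample
points imply exact recovery of the support and the error bound. -/
theorem decoded_correct {f : Cube n → ℂ} {coins : ℕ → Bool} {r : ℕ} {Y : ℕ → ℝ} {η δ ε : ℝ}
    (hη : 0 < η) (hδ : 0 < δ) (hδ' : δ ≤ 1 / 2) (hε : 0 ≤ ε) (hεη : ε ≤ 1 / 4 * (η * δ))
    (hf : ∀ ξ, cubeFourier f ξ ≠ 0 → η ≤ ‖cubeFourier f ξ‖)
    (hinj : ∀ ξ ζ, cubeFourier f ξ ≠ 0 → cubeFourier f ζ ≠ 0 →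
      hash (coinVec coins n) ξ r = hash (coinVec coins n) ζ r → ξ = ζ)
    (hY : ∀ P < (n + 1) * 2 ^ r, |Y P - (f (point coins n r P)).re| ≤ ε ∧
      |Y (P + (n + 1) * 2 ^ r) - (f (point coins n r P)).im| ≤ ε) :
    Function.support (cubeFourier (fun x : Cube n =>
        decoded (bins n r ((n + 1) * 2 ^ r) Y) (2 ^ r) η (2 ^ r) x)) =
      Function.support (cubeFourier f) ∧
    meanAbs (fun x : Cube n => decoded (bins n r ((n + 1) * 2 ^ r) Y) (2 ^ r) η (2 ^ r) x - f x) ≤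
      1 * (ε / δ) := by
  classical
  set N := (n + 1) * 2 ^ r with hN
  set C := bins n r N Y with hC
  set v := coinVec coins n with hv
  set S : Finset (Cube n) := Finset.univ.filter fun ξ => cubeFourier f ξ ≠ 0 with hS
  have memS : ∀ ξ, ξ ∈ S ↔ cubeFourier f ξ ≠ 0 := fun ξ => by simp [hS]
  have hfS : ∀ x, f x = ∑ ξ ∈ S, cubeFourier f ξ * character ξ x := by
    intro x
    rw [← sum_cubeFourier_mul_character f x, hS, Finset.sum_filter]
    refine Finset.sum_congr rfl fun ξ _ => ?_
    split_ifs with h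
    · rfl
    · rw [not_not.1 h, zero_mul]
  set E : ℕ → ℕ → ℂ := fun l u => measured r N Y l u - f (point coins n r (l * 2 ^ r + u)) with hE
  have hE' : ∀ l ≤ n, ∀ u < 2 ^ r, |(E l u).re| ≤ ε ∧ |(E l u).im| ≤ ε := by
    intro l hl u hu
    have hP : l * 2 ^ r + u < N := by
      rw [hN]
      have : (l + 1) * 2 ^ r ≤ (n + 1) * 2 ^ r := Nat.mul_le_mul_right _ (by omega)
      rw [add_mul, one_mul] at this
      omega
    exact hY _ hP
  have hR : (2 : ℂ) ^ r ≠ 0 := pow_ne_zero _ two_ne_zero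
  -- the content of the bins
  have hbin : ∀ l ≤ n, ∀ b < 2 ^ r, C b l = 2 ^ r *
      ((∑ ξ ∈ S, if hash v ξ r = b then cubeFourier f ξ * character ξ (prefixVec n l) else 0) +
        binError r (E l) b) := by
    intro l hl b hb
    have hm : ∀ u ∈ Finset.range (2 ^ r), measured r N Y l u * (sgn r u b : ℂ) =
        (∑ ξ ∈ S, cubeFourier f ξ * character ξ (prefixVec n l) *
          ((sgn r u (hash v ξ r) * sgn r u b : ℝ) : ℂ)) + E l u * (sgn r u b : ℂ) := by
      intro u hu
      have : measured r N Y l u = f (point coins n r (l * 2 ^ r + u)) + E l u := by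
        simp [hE]
      rw [this, add_mul, hfS, Finset.sum_mul]
      congr 1
      refine Finset.sum_congr rfl fun ξ _ => ?_
      rw [point_eq _ _ _ _ (Finset.mem_range.1 hu), character_add,
        character_spanVal _ _ (Finset.mem_range.1 hu)]
      push_cast
      ring
    rw [hC, bins_eq_hadamard r Y hb hl, Finset.sum_congr rfl hm, Finset.sum_add_distrib,
      Finset.sum_comm, mul_add, binError, mul_div_cancel₀ _ hR, Finset.mul_sum]
    congr 1
    refine Finset.sum_congr rfl fun ξ _ => ?_
    rw [← Finset.mul_sum, ← Complex.ofReal_sum]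
    -- On the sample, the character of `ξ` is the matrix row of its hash value; orthogonality
    -- removes it from every other bin.
    have := hadamard_sgn hb (hash_lt v ξ r)
    rw [hadamard] at this
    rw [this]
    split_ifs <;> simp [mul_comm]
  have hbinS : ∀ l ≤ n, ∀ ξ ∈ S, C (hash v ξ r) l = 2 ^ r *
      (cubeFourier f ξ * character ξ (prefixVec n l) + binError r (E l) (hash v ξ r)) := by
    intro l hl ξ hξ
    rw [hbin l hl _ (hash_lt v ξ r), Finset.sum_eq_single ξ, if_pos rfl]
    · intro ζ hζ hne
      rw [if_neg fun h => hne (hinj ζ ξ ((memS _).1 hζ) ((memS _).1 hξ) h)]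
    · exact fun h => absurd hξ h
  have herr : ∀ l ≤ n, ∀ b < 2 ^ r, ‖binError r (E l) b‖ ≤ η / 4 := by
    intro l hl b hb
    refine abs_le_of_norm_sq_le hη.le (ε := ε) ?_ ?_
    -- From `ε ≤ ηδ/4` and `δ ≤ 1/2`; then `2ε² ≤ η²/32 ≤ (η/4)²`.
    · have : ε ≤ η / 8 := by nlinarith
      nlinarith
    · exact (Finset.single_le_sum (f := fun b => ‖binError r (E l) b‖ ^ 2)
        (fun b _ => by positivity) (Finset.mem_range.2 hb)).trans
        (sum_norm_sq_binError_le r (E l) (hE' l hl))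
  -- the heavy bins are those of the frequencies in the support
  have hheavy : ∀ b < 2 ^ r, Heavy C (2 ^ r) η b ↔ η / 2 ≤ ‖C b 0 / 2 ^ r‖ := by
    intro b _
    rw [Heavy, ← Complex.normSq_apply, Complex.normSq_eq_norm_sq, norm_div, norm_pow,
      Complex.norm_ofNat, le_div_iff₀ (by positivity), Nat.cast_pow, Nat.cast_ofNat]
    have h0 : 0 ≤ η / 2 * 2 ^ r := by positivity
    constructor <;> intro h
    · exact le_of_sq_le_sq (by linarith) (norm_nonneg _)
    · have := mul_self_le_mul_self h0 h
      linarith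
  -- The threshold `η/2` separates empty bins, of size at most `η/4`, from occupied ones, of size at
  -- least `3η/4`.
  have hfilter : (Finset.range (2 ^ r)).filter (Heavy C (2 ^ r) η) =
      S.image fun ξ => hash v ξ r := by
    ext b
    simp only [Finset.mem_filter, Finset.mem_range, Finset.mem_image]
    constructor
    · rintro ⟨hb, hh⟩
      by_contra hno
      push Not at hno
      rw [hheavy b hb, hbin 0 (Nat.zero_le _) b hb, mul_div_cancel_left₀ _ hR,
        Finset.sum_eq_zero fun ξ hξ => if_neg (hno ξ hξ), zero_add] at hh
      linarith [herr 0 (Nat.zero_le _) b hb]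
    · rintro ⟨ξ, hξ, rfl⟩
      have hb := hash_lt v ξ r
      refine ⟨hb, ?_⟩
      rw [hheavy _ hb, hbinS 0 (Nat.zero_le _) ξ hξ, mul_div_cancel_left₀ _ hR]
      have h1 := norm_sub_le (cubeFourier f ξ * character ξ (prefixVec n 0) +
        binError r (E 0) (hash v ξ r)) (binError r (E 0) (hash v ξ r))
      rw [add_sub_cancel_right, norm_mul, norm_character, mul_one] at h1
      linarith [herr 0 (Nat.zero_le _) _ hb, hf ξ ((memS ξ).1 hξ)]
  have hfreq : ∀ ξ ∈ S, (decodeFreq C (hash v ξ r) : Cube n) = ξ := by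
    intro ξ hξ
    funext l
    have hb := hash_lt v ξ r
    have hl : (l : ℕ) ≤ n := l.2.le
    have key := inner_nonneg_iff (character_eq_or ξ (prefixVec n l))
      (character_eq_or ξ (prefixVec n (l + 1))) hη (hf ξ ((memS ξ).1 hξ)) (herr l hl _ hb)
      (herr (l + 1) l.2 _ hb)
    have hpos : (0 : ℝ) < 2 ^ r * 2 ^ r := by positivity
    have hscale : ∀ z w : ℂ, ((2 : ℂ) ^ r * z).re * ((2 : ℂ) ^ r * w).re +
        ((2 : ℂ) ^ r * z).im * ((2 : ℂ) ^ r * w).im =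
        2 ^ r * 2 ^ r * (z.re * w.re + z.im * w.im) := by
      intro z w
      have : (2 : ℂ) ^ r = ((2 ^ r : ℝ) : ℂ) := by push_cast; rfl
      rw [this]
      simp only [Complex.re_ofReal_mul, Complex.im_ofReal_mul]
      ring
    rw [decodeFreq, decodeBit, hbinS l hl ξ hξ, hbinS (l + 1) l.2 ξ hξ, hscale]
    rw [character_prefixVec_succ] at key ⊢
    have hc : character ξ (prefixVec n l) ≠ 0 := by
      intro h
      have := norm_character ξ (prefixVec n l)
      simp [h] at this
    rcases zmod_two_eq_or (ξ l) with h | h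
    · rw [h] at key ⊢
      rw [if_pos]
      exact mul_nonneg hpos.le (key.2 (by simp))
    · rw [h] at key ⊢
      rw [if_neg]
      intro hge
      have := key.1 (nonneg_of_mul_nonneg_right hge hpos)
      simp [ZMod.val_one] at this
      rcases character_eq_or ξ (prefixVec n l) with h' | h' <;> norm_num [h'] at this
  set a : Cube n → ℂ := fun ξ => cubeFourier f ξ + binError r (E 0) (hash v ξ r) with ha
  have hdec : ∀ x : Cube n, decoded C (2 ^ r) η (2 ^ r) x = ∑ ξ ∈ S, a ξ * character ξ x := by
    intro x
    rw [decoded, hfilter, Finset.sum_image fun ξ hξ ζ hζ h =>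
      hinj ξ ζ ((memS _).1 hξ) ((memS _).1 hζ) h]
    refine Finset.sum_congr rfl fun ξ hξ => ?_
    rw [hfreq ξ hξ]
    congr 1
    have h0 : C (hash v ξ r) 0 / 2 ^ r = a ξ := by
      rw [hbinS 0 (Nat.zero_le _) ξ hξ, mul_div_cancel_left₀ _ hR, prefixVec_zero, character_zero,
        mul_one]
    rw [← h0]
    have : (2 : ℂ) ^ r = ((2 ^ r : ℝ) : ℂ) := by push_cast; rfl
    rw [this]
    apply Complex.ext
    · simp only [Complex.div_ofReal_re, Nat.cast_pow, Nat.cast_ofNat]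
    · simp only [Complex.div_ofReal_im, Nat.cast_pow, Nat.cast_ofNat]
  simp only [hdec]
  constructor
  · ext ζ
    rw [Function.mem_support, Function.mem_support, cubeFourier_sum_character]
    constructor
    · intro h
      by_contra h0
      exact h (if_neg fun hm => (memS ζ).1 hm h0)
    · intro h
      rw [if_pos ((memS ζ).2 h)]
      intro h0
      have h1 : cubeFourier f ζ = -binError r (E 0) (hash v ζ r) := eq_neg_of_add_eq_zero_left h0
      have h2 := hf ζ h
      rw [h1, norm_neg] at h2
      linarith [herr 0 (Nat.zero_le _) _ (hash_lt v ζ r)]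
  · have hdiff : (fun x => ∑ ξ ∈ S, a ξ * character ξ x - f x) =
        fun x => ∑ ξ ∈ S, binError r (E 0) (hash v ξ r) * character ξ x := by
      funext x
      rw [hfS x, ← Finset.sum_sub_distrib]
      refine Finset.sum_congr rfl fun ξ _ => ?_
      simp only [ha]
      ring
    rw [hdiff, one_mul]
    refine meanAbs_sum_character_le S _ (by positivity) ?_
    have h1 : ∑ ξ ∈ S, ‖binError r (E 0) (hash v ξ r)‖ ^ 2 ≤ 2 * ε ^ 2 := by
      refine le_trans ?_ (sum_norm_sq_binError_le r (E 0) (hE' 0 (Nat.zero_le _)))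
      -- Since the hash is injective on the support, the errors of the coefficients are errors of
      -- distinct bins.
      rw [← Finset.sum_image (s := S) (g := fun ξ => hash v ξ r)
        (f := fun b => ‖binError r (E 0) b‖ ^ 2)
        fun ξ hξ ζ hζ h => hinj ξ ζ ((memS _).1 hξ) ((memS _).1 hζ) h]
      refine Finset.sum_le_sum_of_subset_of_nonneg ?_ fun _ _ _ => by positivity
      intro b hb
      obtain ⟨ξ, _, rfl⟩ := Finset.mem_image.1 hb
      exact Finset.mem_range.2 (hash_lt v ξ r)
    refine h1.trans ?_
    rw [div_pow, le_div_iff₀ (by positivity)]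
    -- Hence `2ε² ≤ ε²/δ²`, which is why the constant `1` suffices.
    have : δ ^ 2 ≤ 1 / 4 := by nlinarith
    nlinarith [sq_nonneg ε]

end

section

variable {n : ℕ}

/-! ### Collisions -/

instance (p : unitInterval) : IsProbabilityMeasure (bitsLaw p) := by
  unfold bitsLaw; infer_instance

instance (p : unitInterval) : IsProbabilityMeasure (runLaw p) := by
  unfold runLaw; infer_instance

/-- The law of fair coins. -/
abbrev fairLaw : Measure (ℕ → Bool) := bitsLaw ⟨1 / 2, by norm_num, by norm_num⟩

/-- Flip the bit with index `j₀`. -/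
def flipBit (j₀ : ℕ) (ω : ℕ → Bool) : ℕ → Bool := fun j => (if j = j₀ then not else id) (ω j)

/-- A fair bit has the same law as its negation, and the other coordinates are untouched. -/
theorem measurePreserving_flipBit (j₀ : ℕ) : MeasurePreserving (flipBit j₀) fairLaw fairLaw := by
  have hm : ∀ j, Measurable (if j = j₀ then not else id : Bool → Bool) :=
    fun _ => measurable_from_top
  refine ⟨measurable_pi_lambda _ fun j => (hm j).comp (measurable_pi_apply j), ?_⟩
  have := Measure.infinitePi_map_pi (fun _ : ℕ => bernoulliMeasure true false
    (⟨1 / 2, by norm_num, by norm_num⟩ : unitInterval)) hm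
  refine Eq.trans this ?_
  rw [fairLaw, bitsLaw]
  congr 1
  funext j
  have hσ : unitInterval.symm ⟨1 / 2, by norm_num, by norm_num⟩ =
      (⟨1 / 2, by norm_num, by norm_num⟩ : unitInterval) := by
    apply Subtype.ext
    norm_num [unitInterval.coe_symm_eq]
  split_ifs
  · rw [map_bernoulliMeasure' _ _ measurable_from_top, bernoulliMeasure_def, bernoulliMeasure_def,
      hσ, add_comm]
    rfl
  · exact Measure.map_id

theorem measurableSet_finite_dependence {ι : Type*} [Finite ι] (j : ι → ℕ)
    (T : Set (ι → Bool)) : MeasurableSet {ω : ℕ → Bool | (fun i => ω (j i)) ∈ T} := by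
  have hm : Measurable fun (ω : ℕ → Bool) i => ω (j i) :=
    measurable_pi_lambda _ fun i => measurable_pi_apply (j i)
  exact hm (Set.to_countable T).measurableSet

/-- Coin `r * n + l` is coordinate `l` of vector `r` and of no other, so flipping it toggles only
the inner product with vector `r`. -/
theorem hashBit_flipBit (ω : ℕ → Bool) (ξ : Cube n) (r t : ℕ) (l : Fin n) (hl : ξ l = 1) :
    hashBit (coinVec (flipBit (r * n + l) ω) n) ξ t =
      hashBit (coinVec ω n) ξ t + if t = r then 1 else 0 := by
  have hcv : ∀ i : Fin n, coinVec (flipBit (r * n + l) ω) n t i =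
      coinVec ω n t i + if t = r ∧ i = l then 1 else 0 := by
    intro i
    have hiff : t * n + i = r * n + l ↔ t = r ∧ i = l := by
      constructor
      · intro h
        have hn : 0 < n := i.pos
        have hd := congrArg (· / n) h
        have hm := congrArg (· % n) h
        simp only [Nat.mul_add_mod_of_lt i.2, Nat.mul_add_mod_of_lt l.2] at hm
        simp only [mul_comm _ n, Nat.mul_add_div hn, Nat.div_eq_of_lt i.2, Nat.div_eq_of_lt l.2,
          add_zero] at hd
        exact ⟨hd, Fin.ext hm⟩
      · rintro ⟨rfl, rfl⟩; rfl
    simp only [coinVec, flipBit]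
    by_cases h : t = r ∧ i = l
    · rw [if_pos (hiff.2 h), if_pos h]
      cases ω (t * n + i) <;> decide
    · rw [if_neg (mt hiff.1 h), if_neg h]
      simp
  simp only [hashBit, hcv, mul_add, Finset.sum_add_distrib]
  congr 1
  split_ifs with h
  · simp [h, hl]
  · simp [h]

/-- Each further vector halves the probability: flipping one coin, at a coordinate where `ξ` is
nonzero, exchanges the outcomes of the new inner product and leaves the earlier ones alone. -/
theorem measure_hashBit_eq_zero (ξ : Cube n) (hξ : ξ ≠ 0) (r : ℕ) :
    fairLaw.real {ω | ∀ t < r, hashBit (coinVec ω n) ξ t = 0} = (1 / 2) ^ r := by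
  obtain ⟨l, hl⟩ := Function.ne_iff.1 hξ
  have hl : ξ l = 1 := (zmod_two_eq_or (ξ l)).resolve_left hl
  induction r with
  | zero => simp
  | succ r ih =>
    set A := {ω : ℕ → Bool | ∀ t < r, hashBit (coinVec ω n) ξ t = 0} with hA
    set B := {ω : ℕ → Bool | ∀ t < r + 1, hashBit (coinVec ω n) ξ t = 0} with hB
    have hmeas : MeasurableSet B := by
      have := measurableSet_finite_dependence (fun i : Fin (r + 1) × Fin n => (i.1 : ℕ) * n + i.2)
        {x | ∀ t : Fin (r + 1), ∑ i : Fin n, ξ i * ((x (t, i)).toNat : ZMod 2) = 0}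
      convert this using 1
      ext ω
      simp only [hB, Set.mem_ofPred_eq, hashBit, coinVec]
      exact ⟨fun h t => h t t.2, fun h t ht => h ⟨t, ht⟩⟩
    have hpre : flipBit (r * n + l) ⁻¹' B = A \ B := by
      ext ω
      simp only [hA, hB, Set.mem_preimage, Set.mem_ofPred_eq, Set.mem_sdiff,
        hashBit_flipBit _ _ _ _ _ hl]
      constructor
      · intro h
        refine ⟨fun t ht => by simpa [ht.ne] using h t (by omega), fun h' => ?_⟩
        have h1 := h r (by omega)
        rw [h' r (by omega)] at h1
        simp at h1
      · rintro ⟨h, h'⟩ t ht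
        rcases Nat.lt_succ_iff_lt_or_eq.1 ht with ht | rfl
        · simpa [ht.ne] using h t ht
        · have : hashBit (coinVec ω n) ξ t ≠ 0 := fun h0 => h' fun s hs => by
            rcases Nat.lt_succ_iff_lt_or_eq.1 hs with hs | rfl
            exacts [h s hs, h0]
          rw [(zmod_two_eq_or _).resolve_left this]
          simp; rfl
    have hsub : B ⊆ A := fun ω h t ht => h t (by omega)
    have hpres := (measurePreserving_flipBit (r * n + l)).measureReal_preimage
      hmeas.nullMeasurableSet
    rw [hpre] at hpres
    have hadd := measureReal_sdiff_add_inter (μ := fairLaw) (s := A) hmeas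
    rw [Set.inter_eq_right.2 hsub, ih, hpres] at hadd
    rw [pow_succ]
    linarith

theorem one_sub_le_measureReal {Ω : Type*} [MeasurableSpace Ω] (μ : Measure Ω)
    [IsProbabilityMeasure μ] {A : Set Ω} {x : ℝ} (h : μ.real Aᶜ ≤ x) : 1 - x ≤ μ.real A := by
  have := measureReal_union_le (μ := μ) A Aᶜ
  rw [Set.union_compl_self, probReal_univ] at this
  linarith

/-- The random hash function separates a small set of frequencies. -/
theorem measure_injective_hash (S : Finset (Cube n)) (r : ℕ) :
    1 - (S.card : ℝ) ^ 2 * (1 / 2) ^ r ≤ fairLaw.real {ω | ∀ ξ ∈ S, ∀ ζ ∈ S,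
      hash (coinVec ω n) ξ r = hash (coinVec ω n) ζ r → ξ = ζ} := by
  apply one_sub_le_measureReal
  have hsub : {ω | ∀ ξ ∈ S, ∀ ζ ∈ S,
      hash (coinVec ω n) ξ r = hash (coinVec ω n) ζ r → ξ = ζ}ᶜ ⊆
      ⋃ p ∈ S.offDiag, {ω | ∀ t < r, hashBit (coinVec ω n) (p.1 - p.2) t = 0} := by
    intro ω hω
    simp only [Set.mem_compl_iff, Set.mem_ofPred_eq] at hω
    push Not at hω
    obtain ⟨ξ, hξ, ζ, hζ, heq, hne⟩ := hω
    -- A collision means that the difference of the two frequencies is orthogonal to all the random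
    -- vectors; the union bound runs over ordered pairs.
    refine Set.mem_biUnion (x := (ξ, ζ)) (Finset.mem_coe.2 (Finset.mem_offDiag.2 ⟨hξ, hζ, hne⟩)) ?_
    intro t ht
    have := hashBit_eq_of_hash_eq heq t ht
    simp only [hashBit, Pi.sub_apply, sub_mul, Finset.sum_sub_distrib] at this ⊢
    rw [this, sub_self]
  refine (measureReal_mono hsub (measure_ne_top _ _)).trans ((measureReal_biUnion_finset_le _ _).trans ?_)
  have : ∀ p ∈ S.offDiag,
      fairLaw.real {ω | ∀ t < r, hashBit (coinVec ω n) (p.1 - p.2) t = 0} = (1 / 2) ^ r :=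
    fun p hp => measure_hashBit_eq_zero _ (sub_ne_zero.2 (Finset.mem_offDiag.1 hp).2.2) r
  rw [Finset.sum_congr rfl this, Finset.sum_const, nsmul_eq_mul]
  gcongr
  rw [Finset.offDiag_card, sq, ← Nat.cast_mul]
  exact Nat.cast_le.2 (Nat.sub_le _ _)

/-! ### Outliers -/

/-- The expected number of outliers is `m (1/2 - δ)`, so a tie or worse is a deviation of at least
`m δ`. Hoeffding's inequality applies with sub-Gaussian parameter `1/4` for each indicator. -/
theorem measure_many_outliers {ρ : unitInterval} {δ : ℝ} (hδ : 0 ≤ δ)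
    (hρ : (ρ : ℝ) = 1 / 2 - δ) (m a : ℕ) (hm : 0 < m) :
    (bitsLaw ρ).real {ω | m ≤ 2 * Nat.count (fun q => ω (a + q) = true) m} ≤
      Real.exp (-2 * (m * δ ^ 2)) := by
  set X : ℕ → (ℕ → Bool) → ℝ := fun i ω => if ω (a + i) = true then 1 else 0 with hX
  have hg : Measurable fun b : Bool => (if b = true then (1 : ℝ) else 0) := measurable_from_top
  have hmeas : ∀ i, Measurable (X i) := fun i => hg.comp (measurable_pi_apply (a + i))
  have hint : ∀ i, ∫ ω, X i ω ∂(bitsLaw ρ) = ρ := by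
    intro i
    have hmp := measurePreserving_eval_infinitePi (fun _ : ℕ => bernoulliMeasure true false ρ)
      (a + i)
    have h1 := integral_map (μ := bitsLaw ρ) (φ := Function.eval (a + i)) hmp.measurable.aemeasurable
      (f := fun b : Bool => (if b = true then (1 : ℝ) else 0)) hg.aestronglyMeasurable
    have h2 : ∫ ω, X i ω ∂(bitsLaw ρ) =
        ∫ ω, (if Function.eval (a + i) ω = true then (1 : ℝ) else 0) ∂(bitsLaw ρ) := rfl
    rw [h2, ← h1, bitsLaw, hmp.map_eq, integral_bernoulliMeasure]
    simp
  have hind : iIndepFun (fun i ω => X i ω - ∫ ω, X i ω ∂(bitsLaw ρ)) (bitsLaw ρ) := by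
    have h0 : iIndepFun (fun i (ω : ℕ → Bool) => (fun b : Bool =>
        (if b = true then (1 : ℝ) else 0) - ρ) (ω i)) (bitsLaw ρ) :=
      iIndepFun_infinitePi fun i => hg.sub_const _
    have := h0.precomp (g := fun i => a + i) (add_right_injective a)
    simpa only [hint] using this
  have hsub : ∀ i < m, HasSubgaussianMGF (fun ω => X i ω - ∫ ω, X i ω ∂(bitsLaw ρ))
      ((‖(1 : ℝ) - 0‖₊ / 2) ^ 2) (bitsLaw ρ) := by
    intro i _
    refine hasSubgaussianMGF_of_mem_Icc (hmeas i).aemeasurable (Filter.Eventually.of_forall ?_)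
    intro ω
    simp only [hX]
    split_ifs <;> simp
  have h := HasSubgaussianMGF.measure_sum_range_ge_le_of_iIndepFun hind hsub
    (ε := m * δ) (by positivity)
  refine (measureReal_mono ?_).trans (h.trans (le_of_eq ?_))
  · intro ω hω
    have hcount : ((Nat.count (fun q => ω (a + q) = true) m : ℕ) : ℝ) =
        ∑ i ∈ Finset.range m, X i ω := by
      simp only [hX, Nat.count_eq_card_filter_range, Finset.sum_boole]
    have hω : (m : ℝ) ≤ 2 * (Nat.count (fun q => ω (a + q) = true) m : ℕ) := by
      exact_mod_cast hω
    simp only [Set.mem_ofPred_eq, hint, Finset.sum_sub_distrib, Finset.sum_const, Finset.card_range,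
      nsmul_eq_mul, ← hcount, hρ]
    linarith
  · congr 1
    have hm' : (m : ℝ) ≠ 0 := by positivity
    simp
    field_simp

/-- With high probability every point has a majority of good answers. -/
theorem measure_majority {ρ : unitInterval} {δ : ℝ} (hδ : 0 ≤ δ) (hρ : (ρ : ℝ) = 1 / 2 - δ)
    {m N L : ℕ} (hm : 0 < m) (hN : 0 < N) (hL : N ≤ 2 ^ L) (hmL : (L : ℝ) ≤ m * δ ^ 2) :
    1 - 1 / (N : ℝ) ≤ (bitsLaw ρ).real
      {ω | ∀ P < N, 2 * Nat.count (fun q => ω (P * m + q) = true) m < m} := by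
  apply one_sub_le_measureReal
  have hsub : {ω : ℕ → Bool | ∀ P < N, 2 * Nat.count (fun q => ω (P * m + q) = true) m < m}ᶜ ⊆
      ⋃ P ∈ Finset.range N, {ω | m ≤ 2 * Nat.count (fun q => ω (P * m + q) = true) m} := by
    intro ω hω
    simp only [Set.mem_compl_iff, Set.mem_ofPred_eq] at hω
    push Not at hω
    obtain ⟨P, hP, h⟩ := hω
    exact Set.mem_biUnion (Finset.mem_coe.2 (Finset.mem_range.2 hP)) h
  refine (measureReal_mono hsub (measure_ne_top _ _)).trans ((measureReal_biUnion_finset_le _ _).trans ?_)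
  refine (Finset.sum_le_sum fun P _ => measure_many_outliers hδ hρ m (P * m) hm).trans ?_
  have hN' : (0 : ℝ) < N := by positivity
  rw [Finset.sum_const, Finset.card_range, nsmul_eq_mul]
  -- Since `e ≥ 2` and `L ≤ m δ²`, the failure probability of one point is at most `2^(-2L) ≤ 1/N²`;
  -- the union over `N` points leaves `1/N`.
  have hexp : Real.exp (-2 * (m * δ ^ 2)) ≤ 1 / (N : ℝ) ^ 2 := by
    have h2 : (2 : ℝ) ≤ Real.exp 1 := by
      have := Real.add_one_le_exp (1 : ℝ); linarith
    have h3 : (N : ℝ) ^ 2 ≤ Real.exp (2 * (m * δ ^ 2)) := by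
      calc (N : ℝ) ^ 2 ≤ ((2 : ℝ) ^ L) ^ 2 := by gcongr; exact_mod_cast hL
        _ ≤ (Real.exp 1 ^ L) ^ 2 := by gcongr
        _ = Real.exp (2 * L) := by rw [← Real.exp_nat_mul, ← Real.exp_nat_mul]; simp
        _ ≤ _ := Real.exp_le_exp.2 (by linarith)
    rw [neg_mul, Real.exp_neg, ← one_div]
    exact one_div_le_one_div_of_le (by positivity) h3
  calc (N : ℝ) * Real.exp (-2 * (m * δ ^ 2)) ≤ N * (1 / (N : ℝ) ^ 2) := by gcongr
    _ = 1 / N := by field_simp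

end

section

variable {n : ℕ}

/-! ### Query and time bounds -/

theorem two_pow_clog_le {x : ℕ} (hx : 2 ≤ x) : 2 ^ Nat.clog 2 x ≤ 2 * x := by
  have h := Nat.pow_pred_clog_lt_self (b := 2) (by norm_num) hx
  have hpos : 0 < Nat.clog 2 x := Nat.clog_pos (by norm_num) hx
  rw [← Nat.succ_pred_eq_of_pos hpos, pow_succ]
  omega

theorem two_pow_rounds_le {k : ℕ} (hk : 1 ≤ k) : 2 ^ rounds k ≤ 512 * k ^ 2 := by
  have := two_pow_clog_le (x := 256 * k ^ 2) (by nlinarith)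
  rw [rounds]; omega

theorem le_two_pow_rounds (k : ℕ) : 256 * k ^ 2 ≤ 2 ^ rounds k :=
  Nat.le_pow_clog (by norm_num) _

theorem numPoints_le {k : ℕ} (hk : 1 ≤ k) (hn : 1 ≤ n) : numPoints k n ≤ 1024 * (k ^ 2 * n) := by
  calc numPoints k n ≤ (2 * n) * (512 * k ^ 2) :=
        Nat.mul_le_mul (by omega) (two_pow_rounds_le hk)
    _ = _ := by ring

theorem reps_le (k : ℕ) {δ : ℝ} : (reps k n δ : ℝ) ≤ logPoints k n / δ ^ 2 + 1 := by
  rw [sq]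
  exact (Nat.ceil_lt_add_one (div_nonneg (Nat.cast_nonneg _) (mul_self_nonneg δ))).le

theorem le_reps_mul (k : ℕ) {δ : ℝ} (hδ : 0 < δ) : (logPoints k n : ℝ) ≤ reps k n δ * δ ^ 2 := by
  rw [← div_le_iff₀ (by positivity), sq]
  exact Nat.le_ceil _

/-- Rounding up costs a factor of two, so `2^logPoints ≤ 2048 k² n ≤ 2^9 T`. As `log T ≥ 2 log 2`,
the nine extra bits are absorbed into the factor `8`. -/
theorem logPoints_le_log {k : ℕ} {T : ℝ} (hk : 1 ≤ k) (hn : 1 ≤ n)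
    (hT : 4 * ((k : ℝ) ^ 2 * n) ≤ T) : (logPoints k n : ℝ) ≤ 8 * Real.log T := by
  have hkn : (1 : ℝ) ≤ (k : ℝ) ^ 2 * n := by exact_mod_cast Nat.mul_pos (pow_pos hk 2) hn
  have hT4 : (4 : ℝ) ≤ T := by linarith
  have h1 : (2 : ℝ) ^ logPoints k n ≤ 2 ^ 9 * T := by
    have h := two_pow_clog_le (two_le_numPoints (n := n) k hn)
    have h' := numPoints_le hk hn
    have : 2 ^ logPoints k n ≤ 2048 * (k ^ 2 * n) := by rw [logPoints]; omega
    have : (2 : ℝ) ^ logPoints k n ≤ 2048 * ((k : ℝ) ^ 2 * n) := by exact_mod_cast this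
    linarith
  have h2 := Real.log_le_log (by positivity) h1
  rw [Real.log_mul (by norm_num) (by linarith), Real.log_pow, Real.log_pow] at h2
  have h3 : 2 * Real.log 2 ≤ Real.log T := by
    have := Real.log_le_log (by norm_num) hT4
    rwa [show (4 : ℝ) = 2 ^ 2 by norm_num, Real.log_pow] at this
  have h4 := Real.log_two_gt_d9
  push_cast at h2 h3
  nlinarith

theorem four_mul_le_div_sq {x δ : ℝ} (hx : 0 ≤ x) (hδ : 0 < δ) (hδ' : δ ≤ 1 / 2) :
    4 * x ≤ x / δ ^ 2 := by
  rw [le_div_iff₀ (by positivity)]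
  have : δ ^ 2 ≤ 1 / 4 := by nlinarith
  nlinarith

theorem queries_le {k : ℕ} {δ : ℝ} (hk : 1 ≤ k) (hn : 1 ≤ n) (hδ : 0 < δ) (hδ' : δ ≤ 1 / 2) :
    ((numPoints k n * reps k n δ : ℕ) : ℝ) ≤
      9216 * ((k : ℝ) ^ 2 * n / δ ^ 2) * Real.log ((k : ℝ) ^ 2 * n / δ ^ 2) ^ 1 := by
  have hkn : (1 : ℝ) ≤ (k : ℝ) ^ 2 * n := by exact_mod_cast Nat.mul_pos (pow_pos hk 2) hn
  have hT := four_mul_le_div_sq (x := (k : ℝ) ^ 2 * n) (by linarith) hδ hδ'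
  set T := (k : ℝ) ^ 2 * n / δ ^ 2 with hTdef
  have hL := logPoints_le_log hk hn hT
  have hlog : 1 ≤ Real.log T := by
    have := Real.log_le_log (by norm_num) (show (4 : ℝ) ≤ T by linarith)
    rw [show (4 : ℝ) = 2 ^ 2 by norm_num, Real.log_pow] at this
    have := Real.log_two_gt_d9
    push_cast at *
    linarith
  have hN : (numPoints k n : ℝ) ≤ 1024 * ((k : ℝ) ^ 2 * n) := by exact_mod_cast numPoints_le hk hn
  have h1 : (1 : ℝ) ≤ Real.log T / δ ^ 2 := by
    rw [le_div_iff₀ (by positivity)]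
    nlinarith
  -- The ceiling adds at most `1 ≤ log T / δ²`, hence `9 = 8 + 1`; together with `1024` from the
  -- number of points this gives `9216`.
  have hm : (reps k n δ : ℝ) ≤ 9 * (Real.log T / δ ^ 2) := by
    have h2 : (logPoints k n : ℝ) / δ ^ 2 ≤ 8 * Real.log T / δ ^ 2 := by gcongr
    have := reps_le (n := n) k (δ := δ)
    rw [mul_div_assoc] at h2
    linarith
  push_cast
  calc (numPoints k n : ℝ) * reps k n δ ≤
        1024 * ((k : ℝ) ^ 2 * n) * (9 * (Real.log T / δ ^ 2)) := by gcongr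
    _ = _ := by rw [hTdef]; ring

/-- All parameters are replaced by one majorant `Z`; the coefficients of the resulting cubic add up
to less than `3000`. -/
theorem stepBound_le {k : ℕ} {δ Z : ℝ} (hZ : 1 ≤ Z) (hn : (n : ℝ) ≤ Z)
    (hR : (2 : ℝ) ^ rounds k ≤ Z) (hN : (numPoints k n : ℝ) ≤ Z) (hm : (reps k n δ : ℝ) ≤ Z) :
    (stepBound k n δ : ℝ) ≤ 3000 * Z ^ 4 := by
  have hr : (rounds k : ℝ) ≤ Z := by
    refine le_trans ?_ hR
    exact_mod_cast Nat.lt_two_pow_self.le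
  have hL : (logPoints k n : ℝ) ≤ Z := by
    refine le_trans ?_ hN
    exact_mod_cast Nat.clog_le_of_le_pow Nat.lt_two_pow_self.le
  have h1 : Z ≤ Z ^ 4 := le_self_pow₀ hZ (by norm_num)
  have h2 : Z ^ 2 ≤ Z ^ 4 := pow_le_pow_right₀ hZ (by norm_num)
  have h3 : Z ^ 3 ≤ Z ^ 4 := pow_le_pow_right₀ hZ (by norm_num)
  have hZ0 : 0 ≤ Z := by linarith
  rw [stepBound]
  push_cast
  calc _ ≤ Z * (200 * (Z * Z) + 220) + Z * (Z * Z * 100 + 100) + (50 * Z + 50 * Z) +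
        Z * (2 * (Z * (Z * 120 + Z + 300)) + 200) + Z * (Z * 100 + 100) +
        Z * (Z * 120 + 300) + 600 := by gcongr
    _ = 542 * Z ^ 3 + 820 * Z ^ 2 + 1020 * Z + 600 := by ring
    _ ≤ _ := by nlinarith

theorem steps_le {k : ℕ} {η δ : ℝ} (hk : 1 ≤ k) (hn : 1 ≤ n) (hη : 0 < η) (hδ : 0 < δ) :
    (stepBound k n δ : ℝ) ≤ (3000 * 1025 ^ 4) * ((k : ℝ) + n + 1 / δ + 1 / η) ^ 20 := by
  obtain ⟨x, hx⟩ : ∃ x, x = (k : ℝ) + n + 1 / δ + 1 / η := ⟨_, rfl⟩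
  rw [← hx]
  have hδ0 : 0 < 1 / δ := by positivity
  have hη0 : 0 < 1 / η := by positivity
  have hk1 : (1 : ℝ) ≤ k := by exact_mod_cast hk
  have hn1 : (1 : ℝ) ≤ n := by exact_mod_cast hn
  have hkx : (k : ℝ) ≤ x := by linarith
  have hnx : (n : ℝ) ≤ x := by linarith
  have hδx : 1 / δ ≤ x := by linarith
  have hx1 : 1 ≤ x := by linarith
  have hx5 : x ≤ x ^ 5 := le_self_pow₀ hx1 (by norm_num)
  have hx25 : x ^ 2 ≤ x ^ 5 := pow_le_pow_right₀ hx1 (by norm_num)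
  have hx35 : x ^ 3 ≤ x ^ 5 := pow_le_pow_right₀ hx1 (by norm_num)
  have hx05 : 1 ≤ x ^ 5 := one_le_pow₀ hx1
  have hN : (numPoints k n : ℝ) ≤ 1024 * x ^ 3 := by
    have : (numPoints k n : ℝ) ≤ 1024 * ((k : ℝ) ^ 2 * n) := by exact_mod_cast numPoints_le hk hn
    calc (numPoints k n : ℝ) ≤ 1024 * ((k : ℝ) ^ 2 * n) := this
      _ ≤ 1024 * (x ^ 2 * x) := by gcongr
      _ = _ := by ring
  have hL : (logPoints k n : ℝ) ≤ 1024 * x ^ 3 := by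
    refine le_trans ?_ hN
    exact_mod_cast Nat.clog_le_of_le_pow Nat.lt_two_pow_self.le
  -- The number of repetitions dominates: at most `1024 x³` for the logarithm, times `x²` for
  -- `1/δ²`, plus one for the ceiling.
  have h := stepBound_le (n := n) (k := k) (δ := δ) (Z := 1025 * x ^ 5) (by linarith) (by linarith)
    ?_ (by linarith) ?_
  · refine h.trans (le_of_eq ?_)
    rw [mul_pow, ← pow_mul, mul_assoc]
  · have : (2 : ℝ) ^ rounds k ≤ 512 * (k : ℝ) ^ 2 := by exact_mod_cast two_pow_rounds_le hk
    have : (k : ℝ) ^ 2 ≤ x ^ 2 := by gcongr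
    linarith
  · have h1 := reps_le (n := n) k (δ := δ)
    have h2 : (logPoints k n : ℝ) / δ ^ 2 ≤ 1024 * x ^ 5 := by
      calc (logPoints k n : ℝ) / δ ^ 2 = logPoints k n * (1 / δ) ^ 2 := by ring
        _ ≤ 1024 * x ^ 3 * x ^ 2 := by gcongr
        _ = _ := by ring
    linarith

/-! ### The main theorem -/

/-- If the random choices are favourable, the output is correct. -/
theorem output_correct {f : Cube n → ℂ} {k : ℕ} {η δ ε : ℝ} {coins outlier : ℕ → Bool}
    (hn : 1 ≤ n) (hη : 0 < η) (hδ : 0 < δ) (hδ' : δ ≤ 1 / 2) (hε : 0 ≤ ε)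
    (hεη : ε ≤ 1 / 4 * (η * δ)) (hf : ∀ ξ, cubeFourier f ξ ≠ 0 → η ≤ ‖cubeFourier f ξ‖)
    (hinj : ∀ ξ ζ, cubeFourier f ξ ≠ 0 → cubeFourier f ζ ≠ 0 →
      hash (coinVec coins n) ξ (rounds k) = hash (coinVec coins n) ζ (rounds k) → ξ = ζ)
    (hmaj : ∀ P < numPoints k n,
      2 * Nat.count (fun q => outlier (P * reps k n δ + q) = true) (reps k n δ) < reps k n δ)
    {answers : ℕ → ℂ} {t : ℕ} {σ : State n}
    (hex : Exec coins answers program (initState k n η δ) t σ)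
    (hadm : Admissible f ε outlier σ.queries answers) :
    Function.support (cubeFourier (output σ)) = Function.support (cubeFourier f) ∧
      meanAbs (fun x => output σ x - f x) ≤ 1 * (ε / δ) := by
  obtain ⟨t', σ', hex', -, hq, Y, hY, hout⟩ :=
    runs_program (coins := coins) (answers := answers) (k := k) (η := η) hn hδ
  -- Execution is deterministic, so the given run is the one that has been analysed.
  obtain ⟨-, rfl⟩ := hex.unique hex'
  have hgood : ∀ P < numPoints k n, ∀ q < reps k n δ, ¬ outlier (P * reps k n δ + q) = true →
      ‖answers (P * reps k n δ + q) - f (point coins n (rounds k) P)‖ ≤ ε := by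
    intro P hP q hqm hno
    have hj : P * reps k n δ + q < σ.queries.length := by
      rw [hq, List.length_map, List.length_range]
      have : (P + 1) * reps k n δ ≤ numPoints k n * reps k n δ := Nat.mul_le_mul_right _ hP
      rw [add_mul, one_mul] at this
      omega
    have h := hadm _ hj (by simpa using hno)
    have hdiv : (P * reps k n δ + q) / reps k n δ = P := by
      rw [add_comm, Nat.add_mul_div_right _ _ (reps_pos k hn hδ), Nat.div_eq_of_lt hqm, zero_add]
    simpa [hq, hdiv] using h
  rw [show output σ = fun x => decoded (bins n (rounds k) (numPoints k n) Y) (2 ^ rounds k) η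
    (2 ^ rounds k) x from funext hout]
  refine decoded_correct hη hδ hδ' hε hεη hf hinj fun P hP => ⟨?_, ?_⟩
  · refine (hY P hP).1.abs_sub_le (hmaj P hP) fun q hqm hno => ?_
    rw [← Complex.sub_re]
    exact (Complex.abs_re_le_norm _).trans (hgood P hP q hqm hno)
  · refine (hY P hP).2.abs_sub_le (hmaj P hP) fun q hqm hno => ?_
    rw [← Complex.sub_im]
    exact (Complex.abs_im_le_norm _).trans (hgood P hP q hqm hno)

/-- The random choices are favourable with high probability. -/
theorem measure_favourable {k : ℕ} {δ : ℝ} {ρ : unitInterval} (S : Finset (Cube n)) (hk : 1 ≤ k)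
    (hn : 1 ≤ n) (hδ : 0 < δ) (hρ : (ρ : ℝ) = 1 / 2 - δ) (hS : S.card ≤ k) :
    0.99 ≤ (runLaw ρ).real
      ({ω | ∀ ξ ∈ S, ∀ ζ ∈ S, hash (coinVec ω n) ξ (rounds k) = hash (coinVec ω n) ζ (rounds k) →
          ξ = ζ} ×ˢ
        {ω | ∀ P < numPoints k n,
          2 * Nat.count (fun q => ω (P * reps k n δ + q) = true) (reps k n δ) < reps k n δ}) := by
  have h1 := measure_injective_hash S (rounds k)
  have h2 := measure_majority (N := numPoints k n) (L := logPoints k n) hδ.le hρ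
    (reps_pos k hn hδ) (by have := two_le_numPoints k hn; omega) (Nat.le_pow_clog (by norm_num) _)
    (le_reps_mul k hδ)
  -- Hashing depends only on the coins and majorities only on the outlier pattern, so the
  -- probabilities multiply.
  rw [runLaw, measureReal_prod_prod]
  have hk1 : (1 : ℝ) ≤ k := by exact_mod_cast hk
  have hR : 256 * (k : ℝ) ^ 2 ≤ 2 ^ rounds k := by exact_mod_cast le_two_pow_rounds k
  have hb1 : (S.card : ℝ) ^ 2 * (1 / 2) ^ rounds k ≤ 1 / 256 := by
    have hSk : (S.card : ℝ) ≤ k := by exact_mod_cast hS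
    rw [one_div, inv_pow, ← div_eq_mul_inv, div_le_iff₀ (by positivity)]
    have : (S.card : ℝ) ^ 2 ≤ k ^ 2 := by gcongr
    linarith
  have hb2 : 1 / (numPoints k n : ℝ) ≤ 1 / 512 := by
    refine one_div_le_one_div_of_le (by norm_num) ?_
    have : (numPoints k n : ℝ) = (n + 1) * 2 ^ rounds k := by rw [numPoints]; push_cast; rfl
    rw [this]
    have hn1 : (1 : ℝ) ≤ n := by exact_mod_cast hn
    nlinarith
  calc (0.99 : ℝ) ≤ (1 - 1 / 256) * (1 - 1 / 512) := by norm_num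
    _ ≤ _ := mul_le_mul (by linarith) (by linarith) (by norm_num) measureReal_nonneg

end

end SparseFFT

end

theorem mainTheorem1 :
    ∃ (p : SparseFFT.Prog) (c₀ C₁ C₂ C₃ : ℝ) (d₂ d₃ : ℕ),
      0 < c₀ ∧ 0 < C₁ ∧ 0 < C₂ ∧ 0 < C₃ ∧
      ∀ (k n : ℕ) (η δ : ℝ), 1 ≤ k → 1 ≤ n → 0 < η → 0 < δ → δ ≤ 1 / 2 →
        -- for all coins and all answers, the program halts, within the query and time bounds
        (∀ (coins : ℕ → Bool) (answers : ℕ → ℂ), ∃ (t : ℕ) (σ : SparseFFT.State n),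
          SparseFFT.Exec coins answers p (SparseFFT.initState k n η δ) t σ ∧
          (σ.queries.length : ℝ) ≤
            C₂ * ((k : ℝ) ^ 2 * n / δ ^ 2) * Real.log ((k : ℝ) ^ 2 * n / δ ^ 2) ^ d₂ ∧
          (t : ℝ) ≤ C₃ * ((k : ℝ) + n + 1 / δ + 1 / η) ^ d₃) ∧
        -- with probability 0.99 over coins and outlier positions, the output is correct, whatever
        -- the values of the noise are
        ∀ (f : SparseFFT.Cube n → ℂ) (ε : ℝ) (ρ : unitInterval),
          (Function.support (SparseFFT.cubeFourier f)).ncard ≤ k →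
          (∀ ξ, SparseFFT.cubeFourier f ξ ≠ 0 → η ≤ ‖SparseFFT.cubeFourier f ξ‖) →
          0 ≤ ε → ε ≤ c₀ * (η * δ) → (ρ : ℝ) = 1 / 2 - δ →
          0.99 ≤ (SparseFFT.runLaw ρ).real
            {ω | ∀ (answers : ℕ → ℂ) (t : ℕ) (σ : SparseFFT.State n),
              SparseFFT.Exec ω.1 answers p (SparseFFT.initState k n η δ) t σ →
              SparseFFT.Admissible f ε ω.2 σ.queries answers →
              Function.support (SparseFFT.cubeFourier (SparseFFT.output σ)) =
                  Function.support (SparseFFT.cubeFourier f) ∧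
                SparseFFT.meanAbs (fun x => SparseFFT.output σ x - f x) ≤ C₁ * (ε / δ)} := by
  refine ⟨SparseFFT.program, 1 / 4, 1, 9216, 3000 * 1025 ^ 4, 1, 20, by norm_num, by norm_num,
    by norm_num, by norm_num, fun k n η δ hk hn hη hδ hδ' => ⟨fun coins answers => ?_, ?_⟩⟩
  · obtain ⟨t, σ, hex, ht, hq, -⟩ :=
      SparseFFT.runs_program (coins := coins) (answers := answers) (k := k) (η := η) hn hδ
    refine ⟨t, σ, hex, ?_, ?_⟩
    · rw [hq, List.length_map, List.length_range]
      exact SparseFFT.queries_le hk hn hδ hδ'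
    · exact (Nat.cast_le.2 ht).trans (SparseFFT.steps_le hk hn hη hδ)
  · intro f ε ρ hsupp hf hε hεη hρ
    classical
    have hS : (Finset.univ.filter fun ξ => SparseFFT.cubeFourier f ξ ≠ 0).card ≤ k := by
      rw [← Set.ncard_coe_finset]
      convert hsupp using 2
      ext ξ
      simp
    -- The event in question, which quantifies over all answers, need not be shown measurable: it
    -- contains the favourable product event, and monotonicity suffices.
    refine (SparseFFT.measure_favourable _ hk hn hδ hρ hS).trans (measureReal_mono ?_)
    rintro ⟨coins, outlier⟩ ⟨hinj, hmaj⟩ answers t σ hex hadm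
    refine SparseFFT.output_correct hn hη hδ hδ' hε hεη hf (fun ξ ζ hξ hζ => ?_) hmaj hex hadm
    exact hinj ξ (by simpa using hξ) ζ (by simpa using hζ)
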